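/- Let $D\ge 4$, let $(\mathcal M,g)$ and $(\hat{\mathcal M},\hat g)$ be smooth Lorentzian manifolds of dimensions $D$ and $D+1$, and let $\alpha,\beta$ be nonzero constants. Suppose that $(\mathcal M,g)$ is a Kaluza--Klein reduction of $(\hat{\mathcal M},\hat g)$: there are a smooth surjective map $\pi:\hat{\mathcal M}\to\mathcal M$ and a smooth function $z$ on $\hat{\mathcal M}$ such that $(d\pi,dz)_p:T_p\hat{\mathcal M}\to T_{\pi(p)}\mathcal M\times\mathbb R$ is bijective for every $p$, and a smooth function $\phi$ and a smooth $1$-form $\mathcal A$ on $\mathcal M$ with $$\hat g=e^{2\alpha\phi}g+e^{2\beta\phi}(dz+\mathcal A)^2,$$ where $g,\mathcal A,\phi$ are pulled back by $\pi$ (so the coordinate field $\partial_z$, defined by $d\pi(\partial_z)=0$, $dz(\partial_z)=1$, is a spacelike Killing field). A vector of $T_{\pi(p)}\mathcal M$ is regarded as the vector at $p$ that $d\pi$ maps to it and that $dz$ annihilates. A semicolon denotes the Levi-Civita derivative of $g$, and $\mathcal F_{ab}=\mathcal A_{b;a}-\mathcal A_{a;b}$. Let $\ell$ be a nowhere vanishing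 smooth null vector field on $\mathcal M$, and let $\hat\ell=e^{-\alpha\phi}(\ell-\mathcal A(\ell)\,\partial_z)$. Put $L_{ab}=\ell_{a;b}$ and $\kappa^a=\ell^a{}_{;b}\ell^b$. In a null frame $e_{(0)}=\ell,\ e_{(1)},\ e_{(i)}$ ($2\le i\le D-1$), i.e. a basis whose only nonzero scalar products are $g_{(0)(1)}=g_{(1)(0)}=1$ and $g_{(i)(i)}=1$, put $\rho_{ij}=L_{(i)(j)}$ (optical matrix) and $A_{ij}=\rho_{[ij]}=\tfrac12(\rho_{ij}-\rho_{ji})$ (twist). Hatted quantities are the same objects for $(\hat{\mathcal M},\hat g)$ and $\hat\ell$. A vector field $\ell$ is geodetic if $\kappa=0$. A spacetime is Kundt with respect to a nowhere vanishing smooth null field $\ell$ if $\ell$ is geodetic and its optical matrix vanishes (for geodetic $\ell$, this does not depend on the null frame). The boost order of a covariant tensor field with respect to $\ell$ is at most $0$ if, in null frames with $e_{(0)}=\ell$, every frame component with more indices $(0)$ than indices $(1)$ vanishes. 1. For every $p\in\hat{\mathcal M}$ and every null frame of $T_{\pi(p)}\mathcal M$ with $e_{(0)}=\ell$, the vectors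 $$\hat e_{[a]}=e^{-\alpha\phi}(e_{(a)}-\mathcal A_{(a)}\partial_z)\quad(0\le a\le D-1),\qquad \hat e_{[z]}=e^{-\beta\phi}\partial_z$$ form a null frame at $p$ with $\hat e_{[0]}=\hat\ell$, and in these frames, for all $0\le a,b\le D-1$, $$\hat L_{[a][b]}=e^{-\alpha\phi}L_{(a)(b)}-(e^{-\alpha\phi})_{;(0)}\,g_{(a)(b)}+(e^{-\alpha\phi})_{;(a)}\,\ell_{(b)},$$ $$\hat L_{[a][z]}=\hat L_{[z][a]}=\tfrac12 e^{(-2\alpha+\beta)\phi}\mathcal F_{(0)(a)},\qquad \hat L_{[z][z]}=e^{(-\alpha-\beta)\phi}(e^{\beta\phi})_{;(0)}.$$ 2. Consequently, for $2\le i,j\le D-1$, $$\hat\rho_{ij}=e^{-\alpha\phi}\rho_{ij}-(e^{-\alpha\phi})_{;(0)}\delta_{ij},\quad \hat\rho_{iz}=\hat\rho_{zi}=\tfrac12e^{(-2\alpha+\beta)\phi}\mathcal F_{(0)(i)},\quad \hat\rho_{zz}=e^{(-\alpha-\beta)\phi}(e^{\beta\phi})_{;(0)},$$ $$\hat A_{ij}=e^{-\alpha\phi}A_{ij},\qquad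 \hat A_{iz}=0.$$ 3. For $0\le a\le D-1$, $$\hat\kappa^{[a]}=e^{-\alpha\phi}\kappa^{(a)}-(e^{-\alpha\phi})_{;(0)}\,\ell^{(a)}=e^{-2\alpha\phi}\,(e^{\alpha\phi}\ell^{(a)})_{;(0)},\qquad \hat\kappa^{[z]}=0,$$ and $\hat\ell$ is geodetic in $(\hat{\mathcal M},\hat g)$ if and only if $e^{\alpha\phi}\ell$ is geodetic in $(\mathcal M,g)$. 4. If $(\mathcal M,g)$ is Kundt with respect to $\ell$ and the boost orders of $\mathcal F$ and $\nabla\phi$ with respect to $\ell$ are both at most $0$, then $(\hat{\mathcal M},\hat g)$ is Kundt with respect to $\hat\ell$. -/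

import Mathlib

open Bundle Set
open scoped Manifold ContDiff

noncomputable section

namespace KK

/-- The model space of `D`-dimensional manifolds (without boundary). -/
abbrev Model (D : ℕ) : Type := EuclideanSpace ℝ (Fin D)

/-! ### Lorentzian metrics -/

/-- A smooth Lorentzian metric, of signature `(-, +, …, +)`, on a `D`-dimensional manifold. -/
structure LorentzianMetric (D : ℕ) (M : Type*) [TopologicalSpace M] [ChartedSpace (Model D) M]
    [IsManifold (𝓡 D) ∞ M] where
  /-- the scalar product `g_x(u, v)` of tangent vectors -/
  val (x : M) : TangentSpace (𝓡 D) x →L[ℝ] TangentSpace (𝓡 D) x →L[ℝ] ℝ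
  symm (x : M) (u v : TangentSpace (𝓡 D) x) : val x u v = val x v u
  lorentzian (x : M) : ∃ b : Module.Basis (Fin D) ℝ (TangentSpace (𝓡 D) x), ∀ i j : Fin D,
    val x (b i) (b j) = if i = j then (if (i : ℕ) = 0 then -1 else 1) else 0
  contMDiff : ContMDiff (𝓡 D) ((𝓡 D).prod 𝓘(ℝ, Model D →L[ℝ] Model D →L[ℝ] ℝ)) ∞
    (fun x ↦ TotalSpace.mk' (Model D →L[ℝ] Model D →L[ℝ] ℝ) x (val x))

section Manifold

variable {D : ℕ} {M : Type*} [TopologicalSpace M] [ChartedSpace (Model D) M]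

/-- Smoothness of a vector field. -/
def SmoothField [IsManifold (𝓡 D) ∞ M] (X : (x : M) → TangentSpace (𝓡 D) x) : Prop :=
  ContMDiff (𝓡 D) (𝓡 D).tangent ∞ (fun x ↦ (⟨x, X x⟩ : TangentBundle (𝓡 D) M))

/-- Smoothness of a `1`-form. -/
def SmoothForm [IsManifold (𝓡 D) ∞ M] (θ : (x : M) → TangentSpace (𝓡 D) x →L[ℝ] ℝ) : Prop :=
  ContMDiff (𝓡 D) ((𝓡 D).prod 𝓘(ℝ, Model D →L[ℝ] ℝ)) ∞
    (fun x ↦ TotalSpace.mk' (Model D →L[ℝ] ℝ) x (θ x))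

/-- The differential `f_{;a} v^a` of a real function. -/
def diff (f : M → ℝ) (x : M) (v : TangentSpace (𝓡 D) x) : ℝ := mvfderiv (𝓡 D) f x v

/-! ### The Levi-Civita covariant derivative, by Christoffel symbols

All derivatives at the point `x` are taken in the chart `extChartAt (𝓡 D) x`. -/

/-- The inverse of the chart at `x`. -/
def param (x : M) : Model D → M := (extChartAt (𝓡 D) x).symm

/-- The coordinate basis at the chart point `y`, as a linear map onto the tangent space. -/
def paramDeriv (x : M) (y : Model D) : Model D →L[ℝ] TangentSpace (𝓡 D) (param x y) :=
  mfderiv 𝓘(ℝ, Model D) (𝓡 D) (param x) y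

/-- The components of a vector field in the chart at `x`. -/
def chartField (X : (x : M) → TangentSpace (𝓡 D) x) (x : M) (y : Model D) : Model D :=
  (paramDeriv x y).inverse (X (param x y))

/-- The components of a `1`-form in the chart at `x`. -/
def chartForm (θ : (x : M) → TangentSpace (𝓡 D) x →L[ℝ] ℝ) (x : M) (y : Model D) :
    Model D →L[ℝ] ℝ :=
  (θ (param x y)).comp (paramDeriv x y)

/-- The components of a vector at `x` in the chart at `x`. -/
def chartVec (x : M) (v : TangentSpace (𝓡 D) x) : Model D :=
  mfderiv (𝓡 D) 𝓘(ℝ, Model D) (extChartAt (𝓡 D) x) x v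

variable [IsManifold (𝓡 D) ∞ M] (g : LorentzianMetric D M)

/-- The components `g_{ab}` of the metric in the chart at `x`. -/
def chartMetric (x : M) (y : Model D) : Model D →L[ℝ] Model D →L[ℝ] ℝ :=
  (ContinuousLinearMap.precomp ℝ (paramDeriv x y)).comp ((g.val (param x y)).comp (paramDeriv x y))

/-- The Christoffel symbols `Γ^c_{ab} v^a u^b = ½ g^{cd} (∂_a g_{bd} + ∂_b g_{ad} - ∂_d g_{ab})
v^a u^b` at the point `x`, in the chart at `x`. -/
def christoffel (x : M) (v u : Model D) : Model D :=
  let y := extChartAt (𝓡 D) x x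
  let G := chartMetric g x
  let dG := fderiv ℝ G y
  (G y).inverse ((1 / 2 : ℝ) • (dG v u + dG u v - (dG.flip v).flip u))

/-- The covariant derivative `∇_v X` of a vector field at the point `x`:
`X^a_{;b} v^b = (∂_b X^a + Γ^a_{bc} X^c) v^b`. -/
def covField (X : (x : M) → TangentSpace (𝓡 D) x) (x : M) (v : TangentSpace (𝓡 D) x) :
    TangentSpace (𝓡 D) x :=
  (mfderiv (𝓡 D) 𝓘(ℝ, Model D) (extChartAt (𝓡 D) x) x).inverse
    (fderiv ℝ (chartField X x) (extChartAt (𝓡 D) x x) (chartVec x v) +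
      christoffel g x (chartVec x v) (chartField X x (extChartAt (𝓡 D) x x)))

/-- The covariant derivative of a `1`-form at the point `x`:
`θ_{a;b} u^a v^b = (∂_b θ_a - Γ^c_{ba} θ_c) u^a v^b`. -/
def covForm (θ : (x : M) → TangentSpace (𝓡 D) x →L[ℝ] ℝ) (x : M)
    (u v : TangentSpace (𝓡 D) x) : ℝ :=
  fderiv ℝ (chartForm θ x) (extChartAt (𝓡 D) x x) (chartVec x v) (chartVec x u) -
    chartForm θ x (extChartAt (𝓡 D) x x) (christoffel g x (chartVec x v) (chartVec x u))

/-- The Maxwell tensor `F_{ab} u^a v^b` with `F_{ab} = A_{b;a} - A_{a;b}`. -/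
def maxwell (A : (x : M) → TangentSpace (𝓡 D) x →L[ℝ] ℝ) (x : M)
    (u v : TangentSpace (𝓡 D) x) : ℝ :=
  covForm g A x v u - covForm g A x u v

/-! ### Null frames and optics -/

/-- The Ricci rotation coefficients `L_{ab} u^a v^b` with `L_{ab} = ℓ_{a;b}`. -/
def ricciRot (l : (x : M) → TangentSpace (𝓡 D) x) (x : M) (u v : TangentSpace (𝓡 D) x) : ℝ :=
  covForm g (fun y ↦ g.val y (l y)) x u v

/-- The non-geodeticity `κ^a = ℓ^a_{;b} ℓ^b`. -/
def nonGeod (l : (x : M) → TangentSpace (𝓡 D) x) (x : M) : TangentSpace (𝓡 D) x :=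
  covField g l x (l x)

/-- `l` generates affinely parametrized geodesics. -/
def IsGeodetic (l : (x : M) → TangentSpace (𝓡 D) x) : Prop := ∀ x, nonGeod g l x = 0

/-- `l` is a (nowhere vanishing) smooth null vector field. -/
structure IsNullField (l : (x : M) → TangentSpace (𝓡 D) x) : Prop where
  smooth : SmoothField l
  ne_zero : ∀ x, l x ≠ 0
  null : ∀ x, g.val x (l x) (l x) = 0

/-- The basis `e_(0), …, e_(D-1)` of the tangent space at `x` is a null frame whose first vector
`e_(0)` is `ℓ` and whose second vector is `n`: the only nonzero scalar products are
`g(ℓ, n) = g(n, ℓ) = 1` and `g(e_(i), e_(i)) = 1` for `i ≥ 2`. -/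
structure IsNullFrame (l : (x : M) → TangentSpace (𝓡 D) x) (x : M)
    (e : Module.Basis (Fin D) ℝ (TangentSpace (𝓡 D) x)) : Prop where
  first : ∀ a : Fin D, (a : ℕ) = 0 → e a = l x
  gram : ∀ a b : Fin D, g.val x (e a) (e b) =
    if ((a : ℕ) = 0 ∧ (b : ℕ) = 1) ∨ ((a : ℕ) = 1 ∧ (b : ℕ) = 0) ∨ (2 ≤ (a : ℕ) ∧ a = b)
      then 1 else 0

end Manifold

/-- The frame indices `2, …, D-1`. -/
abbrev Transverse (D : ℕ) : Type := {a : Fin D // 2 ≤ (a : ℕ)}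

/-- A transverse index of the reduced frame, as an index of the lifted frame. -/
def Transverse.up {D : ℕ} (i : Transverse D) : Transverse (D + 1) :=
  ⟨i.1.castSucc, i.2⟩

/-- The index `z` of the lifted frame, which is its last one. -/
def Transverse.z {D : ℕ} (hD : 4 ≤ D) : Transverse (D + 1) :=
  ⟨Fin.last D, by simp only [Fin.val_last]; omega⟩

section Optics

variable {D : ℕ} {M : Type*} [TopologicalSpace M] [ChartedSpace (Model D) M]
  [IsManifold (𝓡 D) ∞ M] (g : LorentzianMetric D M)

/-- The optical matrix `ρ_{ij} = L_{(i)(j)}`. -/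
def optical (l : (x : M) → TangentSpace (𝓡 D) x) (x : M)
    (e : Module.Basis (Fin D) ℝ (TangentSpace (𝓡 D) x)) :
    Matrix (Transverse D) (Transverse D) ℝ :=
  Matrix.of fun i j ↦ ricciRot g l x (e i.1) (e j.1)

/-- The twist `A_{ij} = ρ_{[ij]}`. -/
def twist (l : (x : M) → TangentSpace (𝓡 D) x) (x : M)
    (e : Module.Basis (Fin D) ℝ (TangentSpace (𝓡 D) x)) :
    Matrix (Transverse D) (Transverse D) ℝ :=
  (1 / 2 : ℝ) • (optical g l x e - (optical g l x e).transpose)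

/-- The spacetime is Kundt with respect to `l`: `l` is a geodetic null vector field with vanishing
optical matrix. (For geodetic `l`, the optical matrix vanishes at a point in one null frame
starting with `l` if and only if it vanishes there in all of them.) -/
structure IsKundt (l : (x : M) → TangentSpace (𝓡 D) x) : Prop where
  nullField : IsNullField g l
  geodetic : IsGeodetic g l
  optical_eq_zero : ∀ x, ∃ e, IsNullFrame g l x e ∧ optical g l x e = 0

/-- The boost weight of a component with (covariant) frame indices `a`: the number of indices `0`
minus the number of indices `1`. -/
def boostWeight {D k : ℕ} (a : Fin k → Fin D) : ℤ :=
  ((Finset.univ.filter fun i ↦ (a i : ℕ) = 0).card : ℤ) -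
    ((Finset.univ.filter fun i ↦ (a i : ℕ) = 1).card : ℤ)

open Classical in
/-- The largest boost weight of a nonzero frame component of a covariant tensor, `-∞` if the
tensor vanishes. -/
def frameBoostOrder {D k : ℕ} {V : Type*} (T : (Fin k → V) → ℝ) (e : Fin D → V) : WithBot ℤ :=
  (Finset.univ.filter fun a : Fin k → Fin D ↦ T (fun i ↦ e (a i)) ≠ 0).sup
    fun a ↦ ((boostWeight a : ℤ) : WithBot ℤ)

/-- The boost order of a covariant tensor field with respect to `l` is at most `b`. -/
def BoostOrderLE (l : (x : M) → TangentSpace (𝓡 D) x) {k : ℕ}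
    (T : (x : M) → (Fin k → TangentSpace (𝓡 D) x) → ℝ) (b : ℤ) : Prop :=
  ∀ x e, IsNullFrame g l x e → frameBoostOrder (T x) e ≤ (b : WithBot ℤ)

end Optics

/-! ### Kaluza–Klein reduction -/

section Reduction

variable {D : ℕ} {M : Type*} [TopologicalSpace M] [ChartedSpace (Model D) M]
  [IsManifold (𝓡 D) ∞ M]
  {N : Type*} [TopologicalSpace N] [ChartedSpace (Model (D + 1)) N]
  [IsManifold (𝓡 (D + 1)) ∞ N]

/-- The `D`-dimensional spacetime `(M, g)` is a Kaluza–Klein reduction, with constants `α`, `β`,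
of the `(D+1)`-dimensional spacetime `(N, ĝ)`.

The map `proj` is a local identification of the hypersurfaces `z = const` of `N` with `M`, so that
`(proj, z)` are local product coordinates on `N`. The metric of `N` is
`ĝ = e^{2αφ} g + e^{2βφ} (dz + A)²` for fields `g`, `A`, `φ` pulled back from `M`; hence the
coordinate field `∂_z` of this product structure is a spacelike Killing field of `ĝ`. -/
structure Reduction (α β : ℝ) (g : LorentzianMetric D M) (gh : LorentzianMetric (D + 1) N) where
  proj : N → M
  z : N → ℝ
  φ : M → ℝ
  A : (x : M) → TangentSpace (𝓡 D) x →L[ℝ] ℝ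
  smooth_proj : ContMDiff (𝓡 (D + 1)) (𝓡 D) ∞ proj
  smooth_z : ContMDiff (𝓡 (D + 1)) 𝓘(ℝ, ℝ) ∞ z
  smooth_φ : ContMDiff (𝓡 D) 𝓘(ℝ, ℝ) ∞ φ
  smooth_A : SmoothForm A
  surjective : Function.Surjective proj
  bijective (p : N) : Function.Bijective
    ((mfderiv (𝓡 (D + 1)) (𝓡 D) proj p).prod (mvfderiv (𝓡 (D + 1)) z p))
  metric_eq (p : N) (u v : TangentSpace (𝓡 (D + 1)) p) :
    gh.val p u v =
      Real.exp (2 * α * φ (proj p)) * g.val (proj p)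
          (mfderiv (𝓡 (D + 1)) (𝓡 D) proj p u) (mfderiv (𝓡 (D + 1)) (𝓡 D) proj p v) +
        Real.exp (2 * β * φ (proj p)) *
          ((mvfderiv (𝓡 (D + 1)) z p u + A (proj p) (mfderiv (𝓡 (D + 1)) (𝓡 D) proj p u)) *
            (mvfderiv (𝓡 (D + 1)) z p v + A (proj p) (mfderiv (𝓡 (D + 1)) (𝓡 D) proj p v)))

namespace Reduction

variable {α β : ℝ} {g : LorentzianMetric D M} {gh : LorentzianMetric (D + 1) N}
  (K : Reduction α β g gh)

/-- The splitting of a tangent space of `N` into the tangent space of `M` and the `z` direction. -/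
def split (p : N) : TangentSpace (𝓡 (D + 1)) p ≃ₗ[ℝ] TangentSpace (𝓡 D) (K.proj p) × ℝ :=
  LinearEquiv.ofBijective
    (((mfderiv (𝓡 (D + 1)) (𝓡 D) K.proj p).prod
      (mvfderiv (𝓡 (D + 1)) K.z p)).toLinearMap) (K.bijective p)

/-- The coordinate vector `∂_z`. -/
def delZ (p : N) : TangentSpace (𝓡 (D + 1)) p := (K.split p).symm (0, 1)

/-- The pushforward of a vector of `M` to the hypersurface `z = const` through `p`. -/
def push (p : N) (v : TangentSpace (𝓡 D) (K.proj p)) : TangentSpace (𝓡 (D + 1)) p :=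
  (K.split p).symm (v, 0)

/-- The lift `e^{-αφ} (v - A(v) ∂_z)` of a vector of `M`. -/
def lift (p : N) (v : TangentSpace (𝓡 D) (K.proj p)) : TangentSpace (𝓡 (D + 1)) p :=
  Real.exp (-α * K.φ (K.proj p)) • (K.push p v - K.A (K.proj p) v • K.delZ p)

/-- The additional frame vector `e^{-βφ} ∂_z`. -/
def liftZ (p : N) : TangentSpace (𝓡 (D + 1)) p :=
  Real.exp (-β * K.φ (K.proj p)) • K.delZ p

/-- The lift of a vector field on `M` to `N`. -/
def liftField (l : (x : M) → TangentSpace (𝓡 D) x) (p : N) : TangentSpace (𝓡 (D + 1)) p :=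
  K.lift p (l (K.proj p))

end Reduction

end Reduction

end KK

end

noncomputable section

namespace KK

/-! ### Charts: the derivative of a chart and of its inverse, and smoothness of components -/

section Chart

variable {D : ℕ} {M : Type*} [TopologicalSpace M] [ChartedSpace (Model D) M]

/-! Everything follows from one formula for the Ricci rotation coefficients of the lifted field on
arbitrary pairs of vectors. In a chart they have the Koszul form `L(u,v) = ∂_v ℓ_u - ½ (∂_v g(u,ℓ) +
∂_u g(v,ℓ) - ∂_ℓ g(v,u))` (`ricciRot_eq`), so only first derivatives of the metric and of the
lowered field enter. In the charts at `p` and at `π(p)`, the projection becomes a smooth map `P` and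
`z` a function `ζ`. The metric upstairs is then `e^{2αφ} P^*g + e^{2βφ} (dζ + P^*A)²`. Since the
gauge form `η = dz + A` vanishes on the lift of `ℓ`, the lowered lift is `e^{αφ} P^*(ℓ_♭)`.
Coordinates adapted to `P` and `ζ` are unnecessary: their second derivatives appear, but cancel
because they are symmetric (`kk_koszul`). What remains is `L` downstairs, the derivatives of `φ`,
and `F(ℓ, ·)` multiplied by `η` (`Reduction.ricciRot_liftField`).

The components are read off from two facts. A lift of `v` projects to `e^{-αφ} v` and has `η = 0`;
the unit vector `e^{-βφ} ∂_z` projects to `0` and has `η = e^{-βφ}`.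

For the non-geodeticity, `g(∇_v X, u) = L(u,v)` (`val_covField`) reduces `κ` to the same formula.
Since `g(ℓ,ℓ) = 0` and `F(ℓ,ℓ) = 0`, what is left is again a lift (`Reduction.nonGeod_liftField`),
and the Leibniz rule identifies it with a multiple of the derivative of `e^{αφ} ℓ` along `ℓ`.
Surjectivity of `π` carries the geodetic criterion to all of `M`. In the Kundt case the boost orders
force `dφ(ℓ) = 0` and `F(ℓ, e_(i)) = 0`, and every term of the lifted optical matrix and of `κ`
vanishes. -/

lemma param_extChartAt {x x' : M} (h : x' ∈ (extChartAt (𝓡 D) x).source) :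
    param x (extChartAt (𝓡 D) x x') = x' :=
  (extChartAt (𝓡 D) x).left_inv h

lemma param_extChartAt_self (x : M) : param x (extChartAt (𝓡 D) x x) = x :=
  extChartAt_to_inv x

lemma paramDeriv_eq_mfderivWithin (x : M) (y : Model D) :
    paramDeriv x y = mfderivWithin 𝓘(ℝ, Model D) (𝓡 D) (extChartAt (𝓡 D) x).symm
      (range (𝓡 D)) y := by
  rw [ModelWithCorners.Boundaryless.range_eq_univ, mfderivWithin_univ]
  rfl

lemma target_mem_nhds (x : M) :
    (extChartAt (𝓡 D) x).target ∈ nhds (extChartAt (𝓡 D) x x) :=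
  extChartAt_target_mem_nhds x

variable [IsManifold (𝓡 D) ∞ M]

/-- The tangent space at `x` is identified with the model space through the preferred chart at `x`,
so the derivative of that chart at `x` is the identity. Hence every model vector is some `chartVec x
u`. -/
lemma chartVec_eq (x : M) (v : TangentSpace (𝓡 D) x) : chartVec x v = (v : Model D) := by
  unfold chartVec
  rw [mfderiv_extChartAt_self]
  rfl

/-- `paramDeriv` with values in the model space. -/
def paramD (x : M) (y : Model D) : Model D →L[ℝ] Model D := paramDeriv x y

/-- The derivative of the chart at `x` at the point `x'`, with values in the model space. -/
def chartD (x x' : M) : Model D →L[ℝ] Model D :=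
  mfderiv (𝓡 D) 𝓘(ℝ, Model D) (extChartAt (𝓡 D) x) x'

lemma chartD_comp_paramD {x : M} {y : Model D} (hy : y ∈ (extChartAt (𝓡 D) x).target) :
    (chartD x (param x y)).comp (paramD x y) = ContinuousLinearMap.id ℝ (Model D) := by
  have h := mfderiv_extChartAt_comp_mfderivWithin_extChartAt_symm (I := 𝓡 D) hy
  rw [← paramDeriv_eq_mfderivWithin] at h
  exact h

lemma paramD_comp_chartD {x : M} {y : Model D} (hy : y ∈ (extChartAt (𝓡 D) x).target) :
    (paramD x y).comp (chartD x (param x y)) = ContinuousLinearMap.id ℝ (Model D) := by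
  have h := mfderivWithin_extChartAt_symm_comp_mfderiv_extChartAt (I := 𝓡 D) hy
  rw [← paramDeriv_eq_mfderivWithin] at h
  exact h

lemma paramD_self (x : M) : paramD x (extChartAt (𝓡 D) x x) = ContinuousLinearMap.id ℝ (Model D) := by
  have h := mfderivWithin_range_extChartAt_symm (I := 𝓡 D) (x := x)
  rw [← paramDeriv_eq_mfderivWithin] at h
  exact h

/-- Over the chart target `paramDeriv` is invertible, so the `inverse` in `chartField` is a true
inverse there and not the default value `0`. -/
lemma paramD_inverse {x : M} {y : Model D} (hy : y ∈ (extChartAt (𝓡 D) x).target) :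
    (paramD x y).inverse = chartD x (param x y) :=
  ContinuousLinearMap.inverse_eq (paramD_comp_chartD hy) (chartD_comp_paramD hy)

lemma chartField_eq (X : (x : M) → TangentSpace (𝓡 D) x) {x : M} {y : Model D}
    (hy : y ∈ (extChartAt (𝓡 D) x).target) :
    chartField X x y = chartD x (param x y) (X (param x y)) := by
  have h : chartField X x y = (paramD x y).inverse (X (param x y)) := rfl
  rw [h, paramD_inverse hy]

lemma paramD_chartD {x x' : M} (h : x' ∈ (extChartAt (𝓡 D) x).source) (v : Model D) :
    paramD x (extChartAt (𝓡 D) x x') (chartD x x' v) = v := by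
  have := paramD_comp_chartD ((extChartAt (𝓡 D) x).map_source h)
  rw [param_extChartAt h] at this
  exact congrArg (fun f : Model D →L[ℝ] Model D ↦ f v) this

lemma chartD_paramD {x x' : M} (h : x' ∈ (extChartAt (𝓡 D) x).source) (v : Model D) :
    chartD x x' (paramD x (extChartAt (𝓡 D) x x') v) = v := by
  have := chartD_comp_paramD ((extChartAt (𝓡 D) x).map_source h)
  rw [param_extChartAt h] at this
  exact congrArg (fun f : Model D →L[ℝ] Model D ↦ f v) this

lemma chartField_self (X : (x : M) → TangentSpace (𝓡 D) x) (x : M) :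
    chartField X x (extChartAt (𝓡 D) x x) = chartVec x (X x) := by
  rw [chartField_eq X (mem_extChartAt_target x)]
  -- The base points agree only propositionally while the tangent spaces depend on them, so the
  -- point is generalized before substituting. The same device recurs below.
  have h : ∀ x' : M, x' = x → chartD x x' (X x') = chartVec x (X x) := by
    rintro _ rfl; rfl
  exact h _ (param_extChartAt_self x)

lemma contMDiffAt_param (x : M) : ContMDiffAt 𝓘(ℝ, Model D) (𝓡 D) ∞ (param x)
    (extChartAt (𝓡 D) x x) :=
  (contMDiffOn_extChartAt_symm x).contMDiffAt (target_mem_nhds x)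

/-- The trivialization of the tangent bundle at `x` is, fibrewise, the derivative of the chart at
`x`. Smoothness of the section is thus smoothness of these components, and passing between `M` and
the model space is composition with the chart or its inverse. -/
lemma contMDiffAt_section_iff (X : (x : M) → TangentSpace (𝓡 D) x) (x : M) :
    ContMDiffAt (𝓡 D) (𝓡 D).tangent ∞ (fun x ↦ (⟨x, X x⟩ : TangentBundle (𝓡 D) M)) x ↔
      ContDiffAt ℝ ∞ (chartField X x) (extChartAt (𝓡 D) x x) := by
  have h0 : ContMDiffAt (𝓡 D) (𝓡 D).tangent ∞ (fun x ↦ (⟨x, X x⟩ : TangentBundle (𝓡 D) M)) x ↔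
      ContMDiffAt (𝓡 D) 𝓘(ℝ, Model D) ∞ (fun x' ↦ chartD x x' (X x')) x := by
    refine (contMDiffAt_section (IB := 𝓡 D) x).trans ?_
    apply Filter.EventuallyEq.contMDiffAt_iff
    filter_upwards [(chartAt (Model D) x).open_source.mem_nhds (mem_chart_source (Model D) x)]
      with x' hx'
    have := TangentBundle.continuousLinearMapAt_trivializationAt (I := 𝓡 D) hx'
    have h1 : chartD x x' (X x') = (trivializationAt (Model D)
        (TangentSpace (𝓡 D)) x).continuousLinearMapAt ℝ x' (X x') := by
      rw [this]; rfl
    rw [h1]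
    symm
    exact Trivialization.continuousLinearMapAt_apply_of_mem ℝ _ (by simpa using hx') _
  rw [h0, ← contMDiffAt_iff_contDiffAt]
  constructor
  · intro h
    have h2 := ContMDiffAt.comp_of_eq (f := param x) h (contMDiffAt_param x)
      (param_extChartAt_self x)
    refine h2.congr_of_eventuallyEq ?_
    filter_upwards [target_mem_nhds x] with y hy
    exact chartField_eq X hy
  · intro h
    have h2 := ContMDiffAt.comp x h (contMDiffAt_extChartAt (I := 𝓡 D) (n := ∞))
    refine h2.congr_of_eventuallyEq ?_
    filter_upwards [extChartAt_source_mem_nhds (I := 𝓡 D) x] with x' hx'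
    simp only [Function.comp_apply]
    rw [chartField_eq X ((extChartAt (𝓡 D) x).map_source hx'), param_extChartAt hx']


/-- The vector field with constant components `w` in the chart at `x`. -/
def coordField (x : M) (w : Model D) (x' : M) : TangentSpace (𝓡 D) x' :=
  paramD x (extChartAt (𝓡 D) x x') w

/-- Coordinate fields turn smoothness of a form or metric, given as a bundle section, into
smoothness of its components. -/
lemma contMDiffAt_coordField (x : M) (w : Model D) :
    ContMDiffAt (𝓡 D) (𝓡 D).tangent ∞
      (fun x' ↦ (⟨x', coordField x w x'⟩ : TangentBundle (𝓡 D) M)) x := by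
  rw [contMDiffAt_section_iff]
  refine (contDiffAt_const (c := w)).congr_of_eventuallyEq ?_
  filter_upwards [target_mem_nhds x] with y hy
  rw [chartField_eq _ hy]
  exact chartD_paramD ((extChartAt (𝓡 D) x).map_target hy) w

/-- As `F` is finite-dimensional, a basis identifies `F →L[ℝ] G` with a finite power of `G`, where
smoothness is componentwise. -/
lemma contDiffAt_clm_apply_iff {E F G : Type*} [NormedAddCommGroup E] [NormedSpace ℝ E]
    [NormedAddCommGroup F] [NormedSpace ℝ F] [NormedAddCommGroup G] [NormedSpace ℝ G]
    [FiniteDimensional ℝ F] {f : E → F →L[ℝ] G} {y : E} :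
    ContDiffAt ℝ ∞ f y ↔ ∀ w, ContDiffAt ℝ ∞ (fun z ↦ f z w) y := by
  refine ⟨fun h w ↦ h.clm_apply contDiffAt_const, fun h ↦ ?_⟩
  let d := Module.finrank ℝ F
  have hd : d = Module.finrank ℝ (Fin d → ℝ) := (Module.finrank_fin_fun ℝ).symm
  let e₁ := ContinuousLinearEquiv.ofFinrankEq hd
  let e₂ := (e₁.arrowCongr (1 : G ≃L[ℝ] G)).trans (ContinuousLinearEquiv.piRing (Fin d))
  rw [← Function.id_comp f, ← e₂.symm_comp_self]
  exact e₂.symm.contDiff.contDiffAt.comp y (contDiffAt_pi.mpr fun i ↦ h _)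

lemma contDiffAt_comp_param {F : Type*} [NormedAddCommGroup F] [NormedSpace ℝ F] {f : M → F} {x : M}
    (h : ContMDiffAt (𝓡 D) 𝓘(ℝ, F) ∞ f x) :
    ContDiffAt ℝ ∞ (fun y ↦ f (param x y)) (extChartAt (𝓡 D) x x) := by
  rw [← contMDiffAt_iff_contDiffAt]
  exact ContMDiffAt.comp_of_eq (f := param x) h (contMDiffAt_param x) (param_extChartAt_self x)

omit [IsManifold (𝓡 D) ∞ M] in
lemma coordField_param {x : M} {y : Model D} (hy : y ∈ (extChartAt (𝓡 D) x).target) (w : Model D) :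
    coordField x w (param x y) = paramDeriv x y w := by
  have : extChartAt (𝓡 D) x (param x y) = y := (extChartAt (𝓡 D) x).right_inv hy
  change paramD x _ w = paramD x y w
  rw [this]

lemma contDiffAt_chartForm {θ : (x : M) → TangentSpace (𝓡 D) x →L[ℝ] ℝ} (hθ : SmoothForm θ)
    (x : M) : ContDiffAt ℝ ∞ (chartForm θ x) (extChartAt (𝓡 D) x x) := by
  rw [contDiffAt_clm_apply_iff]
  intro w
  have h : ContMDiffAt (𝓡 D) ((𝓡 D).prod 𝓘(ℝ, ℝ)) ∞
      (fun m : M ↦ TotalSpace.mk' ℝ (E := Bundle.Trivial M ℝ) m (θ m (coordField x w m))) x := by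
    apply ContMDiffAt.clm_bundle_apply (F₁ := Model D)
    · exact hθ x
    · exact contMDiffAt_coordField x w
  rw [contMDiffAt_totalSpace] at h
  refine (contDiffAt_comp_param h.2).congr_of_eventuallyEq ?_
  filter_upwards [target_mem_nhds x] with y hy
  simp only [chartForm]
  change _ = θ (param x y) (coordField x w (param x y))
  rw [coordField_param hy]
  rfl

/-! ### The metric in a chart -/

variable (g : LorentzianMetric D M)

lemma chartMetric_apply (x : M) (y u v : Model D) :
    chartMetric g x y u v = g.val (param x y) (paramDeriv x y u) (paramDeriv x y v) := rfl

lemma contDiffAt_chartMetric (x : M) :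
    ContDiffAt ℝ ∞ (chartMetric g x) (extChartAt (𝓡 D) x x) := by
  rw [contDiffAt_clm_apply_iff]
  intro w
  rw [contDiffAt_clm_apply_iff]
  intro w'
  have h : ContMDiffAt (𝓡 D) ((𝓡 D).prod 𝓘(ℝ, ℝ)) ∞
      (fun m : M ↦ TotalSpace.mk' ℝ (E := Bundle.Trivial M ℝ) m
        (g.val m (coordField x w m) (coordField x w' m))) x := by
    apply ContMDiffAt.clm_bundle_apply₂ (F₁ := Model D) (F₂ := Model D)
    · exact g.contMDiff x
    · exact contMDiffAt_coordField x w
    · exact contMDiffAt_coordField x w'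
  rw [contMDiffAt_totalSpace] at h
  refine (contDiffAt_comp_param h.2).congr_of_eventuallyEq ?_
  filter_upwards [target_mem_nhds x] with y hy
  rw [chartMetric_apply, ← coordField_param hy, ← coordField_param hy]
  rfl

lemma chartMetric_symm (x : M) (y u v : Model D) :
    chartMetric g x y u v = chartMetric g x y v u := g.symm _ _ _

/-- `chartMetric` at the image of `x'` in the chart at `x`. -/
lemma chartMetric_extChartAt {x x' : M} (h : x' ∈ (extChartAt (𝓡 D) x).source) (u v : Model D) :
    chartMetric g x (extChartAt (𝓡 D) x x') (chartD x x' u) (chartD x x' v) =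
      g.val x' u v := by
  have h1 : ∀ x'' : M, x'' = x' → ∀ u v : Model D, g.val x'' u v = g.val x' u v := by
    rintro _ rfl _ _; rfl
  have h2 := h1 _ (param_extChartAt h)
    (paramD x (extChartAt (𝓡 D) x x') (chartD x x' u))
    (paramD x (extChartAt (𝓡 D) x x') (chartD x x' v))
  rw [paramD_chartD h, paramD_chartD h] at h2
  rw [← h2]
  have h3 := chartMetric_apply g x (extChartAt (𝓡 D) x x') (chartD x x' u) (chartD x x' v)
  rw [h3]
  change g.val _ (paramD x (extChartAt (𝓡 D) x x') (chartD x x' u))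
    (paramD x (extChartAt (𝓡 D) x x') (chartD x x' v)) = _
  rw [paramD_chartD h, paramD_chartD h]

lemma chartForm_extChartAt (θ : (x : M) → TangentSpace (𝓡 D) x →L[ℝ] ℝ)
    {x x' : M} (h : x' ∈ (extChartAt (𝓡 D) x).source) (u : Model D) :
    chartForm θ x (extChartAt (𝓡 D) x x') (chartD x x' u) = θ x' u := by
  have h1 : ∀ x'' : M, x'' = x' → ∀ u : Model D, θ x'' u = θ x' u := by
    rintro _ rfl _; rfl
  change θ _ (paramD x (extChartAt (𝓡 D) x x') (chartD x x' u)) = _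
  rw [paramD_chartD h]
  exact h1 _ (param_extChartAt h) u

lemma chartMetric_self (x : M) (u v : TangentSpace (𝓡 D) x) :
    chartMetric g x (extChartAt (𝓡 D) x x) (chartVec x u) (chartVec x v) = g.val x u v :=
  chartMetric_extChartAt g (mem_extChartAt_source (I := 𝓡 D) x) u v

lemma chartForm_self (θ : (x : M) → TangentSpace (𝓡 D) x →L[ℝ] ℝ) (x : M)
    (u : TangentSpace (𝓡 D) x) :
    chartForm θ x (extChartAt (𝓡 D) x x) (chartVec x u) = θ x u :=
  chartForm_extChartAt θ (mem_extChartAt_source (I := 𝓡 D) x) u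

/-- Pairing with the `i`-th vector of an orthonormal basis returns the `i`-th coordinate up to sign.
-/
lemma nondegenerate {x : M} {u : TangentSpace (𝓡 D) x} (h : ∀ v, g.val x u v = 0) : u = 0 := by
  obtain ⟨b, hb⟩ := g.lorentzian x
  apply b.ext_elem
  intro i
  have h1 := h (b i)
  rw [← b.sum_repr u] at h1
  rw [map_sum, sum_apply] at h1
  simp only [map_smul, smul_apply, hb, smul_eq_mul, mul_ite, mul_zero,
    Finset.sum_ite_eq', Finset.mem_univ, if_true] at h1
  rw [map_zero]
  simp only [Finsupp.coe_zero, Pi.zero_apply]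
  split_ifs at h1 <;> simpa using h1

/-- Nondegeneracy gives injectivity, and the dual has the same finite dimension. The `inverse` in
`christoffel` is therefore genuine. -/
lemma chartMetric_isInvertible (x : M) :
    (chartMetric g x (extChartAt (𝓡 D) x x)).IsInvertible := by
  set G := chartMetric g x (extChartAt (𝓡 D) x x)
  have hinj : Function.Injective G.toLinearMap := by
    rw [injective_iff_map_eq_zero]
    intro w hw
    obtain ⟨u, rfl⟩ : ∃ u : TangentSpace (𝓡 D) x, chartVec x u = w := ⟨w, chartVec_eq x w⟩
    have hu : u = 0 := nondegenerate g fun v ↦ (chartMetric_self g x u v).symm.trans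
      (congrArg (fun f : Model D →L[ℝ] ℝ ↦ f (chartVec x v)) hw)
    rw [hu]
    exact map_zero (mfderiv (𝓡 D) 𝓘(ℝ, Model D) (extChartAt (𝓡 D) x) x)
  have hd : Module.finrank ℝ (Model D) = Module.finrank ℝ (Model D →L[ℝ] ℝ) := by
    rw [(LinearMap.toContinuousLinearMap (𝕜 := ℝ) (E := Model D) (F' := ℝ)).symm.finrank_eq]
    exact (Subspace.dual_finrank_eq).symm
  let e := LinearEquiv.ofInjectiveOfFinrankEq G.toLinearMap hinj hd
  exact ⟨e.toContinuousLinearEquiv, by ext; rfl⟩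


/-! ### Christoffel symbols and the Koszul formula -/

variable (g : LorentzianMetric D M)

lemma fderiv_bilin_apply {E : Type*} [NormedAddCommGroup E] [NormedSpace ℝ E]
    {G : E → E →L[ℝ] E →L[ℝ] ℝ} {y : E} (hG : DifferentiableAt ℝ G y) (w a b : E) :
    fderiv ℝ (fun y ↦ G y a b) y w = fderiv ℝ G y w a b := by
  have h1 : DifferentiableAt ℝ (fun y ↦ G y a) y := hG.clm_apply (differentiableAt_const a)
  rw [fderiv_clm_apply h1 (differentiableAt_const b),
    fderiv_clm_apply hG (differentiableAt_const a)]
  simp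

lemma differentiableAt_chartMetric (x : M) :
    DifferentiableAt ℝ (chartMetric g x) (extChartAt (𝓡 D) x x) :=
  (contDiffAt_chartMetric g x).differentiableAt (by simp)

/-- The derivative `∂_w g_{ab} u^a v^b` of the metric components in the chart at `x`. -/
def dMetric (x : M) (w u v : Model D) : ℝ :=
  fderiv ℝ (chartMetric g x) (extChartAt (𝓡 D) x x) w u v

lemma christoffel_spec (x : M) (v u w : Model D) :
    chartMetric g x (extChartAt (𝓡 D) x x) (christoffel g x v u) w =
      1 / 2 * (dMetric g x v u w + dMetric g x u v w - dMetric g x w v u) := by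
  obtain ⟨e, he⟩ := chartMetric_isInvertible g x
  unfold christoffel
  simp only
  rw [← he, ContinuousLinearMap.inverse_equiv]
  change e (e.symm _) w = _
  rw [e.apply_symm_apply]
  rfl

lemma dMetric_symm (x : M) (w u v : Model D) : dMetric g x w u v = dMetric g x w v u := by
  unfold dMetric
  rw [← fderiv_bilin_apply (differentiableAt_chartMetric g x),
    ← fderiv_bilin_apply (differentiableAt_chartMetric g x)]
  simp_rw [chartMetric_symm g x _ v u]

lemma christoffel_symm (x : M) (v u : Model D) : christoffel g x v u = christoffel g x u v := by
  obtain ⟨e, he⟩ := chartMetric_isInvertible g x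
  have hinj : Function.Injective (chartMetric g x (extChartAt (𝓡 D) x x)) := by
    rw [← he]; exact e.injective
  apply hinj
  ext w
  rw [christoffel_spec, christoffel_spec, dMetric_symm g x w v u]
  ring

/-- The Christoffel terms cancel by their symmetry: `F = dA`, independently of the metric. -/
lemma maxwell_eq (A : (x : M) → TangentSpace (𝓡 D) x →L[ℝ] ℝ) (x : M)
    (u v : TangentSpace (𝓡 D) x) :
    maxwell g A x u v =
      fderiv ℝ (chartForm A x) (extChartAt (𝓡 D) x x) (chartVec x u) (chartVec x v) -
      fderiv ℝ (chartForm A x) (extChartAt (𝓡 D) x x) (chartVec x v) (chartVec x u) := by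
  unfold maxwell covForm
  rw [christoffel_symm g x (chartVec x u)]
  ring

/-- The Koszul form of the Ricci rotation coefficients. -/
lemma ricciRot_eq (l : (x : M) → TangentSpace (𝓡 D) x) (x : M) (u v : TangentSpace (𝓡 D) x) :
    ricciRot g l x u v =
      fderiv ℝ (chartForm (fun y ↦ g.val y (l y)) x) (extChartAt (𝓡 D) x x)
        (chartVec x v) (chartVec x u) -
      1 / 2 * (dMetric g x (chartVec x v) (chartVec x u) (chartVec x (l x)) +
        dMetric g x (chartVec x u) (chartVec x v) (chartVec x (l x)) -
        dMetric g x (chartVec x (l x)) (chartVec x v) (chartVec x u)) := by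
  unfold ricciRot covForm
  have h : ∀ w, chartForm (fun y ↦ g.val y (l y)) x (extChartAt (𝓡 D) x x) w =
      chartMetric g x (extChartAt (𝓡 D) x x) w (chartVec x (l x)) := by
    intro w
    obtain ⟨w, rfl⟩ : ∃ w' : TangentSpace (𝓡 D) x, chartVec x w' = w := ⟨w, chartVec_eq x w⟩
    rw [chartMetric_symm, chartMetric_self, chartForm_self]
  rw [h, christoffel_spec]

lemma chartVec_covField (X : (x : M) → TangentSpace (𝓡 D) x) (x : M) (v : TangentSpace (𝓡 D) x) :
    chartVec x (covField g X x v) =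
      fderiv ℝ (chartField X x) (extChartAt (𝓡 D) x x) (chartVec x v) +
      christoffel g x (chartVec x v) (chartVec x (X x)) := by
  rw [chartVec_eq]
  unfold covField
  rw [chartField_self, mfderiv_extChartAt_self]
  exact congrArg (fun f : Model D →L[ℝ] Model D ↦ f _) (ContinuousLinearMap.inverse_id)

lemma contDiffAt_chartField {X : (x : M) → TangentSpace (𝓡 D) x} (hX : SmoothField X) (x : M) :
    ContDiffAt ℝ ∞ (chartField X x) (extChartAt (𝓡 D) x x) :=
  (contMDiffAt_section_iff X x).1 (hX x)

lemma chartForm_lower (X : (x : M) → TangentSpace (𝓡 D) x) {x : M} {y : Model D}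
    (hy : y ∈ (extChartAt (𝓡 D) x).target) :
    chartForm (fun y ↦ g.val y (X y)) x y = chartMetric g x y (chartField X x y) := by
  ext w
  have h : paramD x y (chartField X x y) = X (param x y) := by
    rw [chartField_eq X hy]
    exact congrArg (fun f : Model D →L[ℝ] Model D ↦ f (X (param x y))) (paramD_comp_chartD hy)
  rw [chartMetric_apply]
  change g.val (param x y) (X (param x y)) _ = g.val (param x y) (paramD x y _) _
  rw [h]
  rfl

lemma fderiv_chartForm_lower {X : (x : M) → TangentSpace (𝓡 D) x} (hX : SmoothField X) (x : M)
    (v u : Model D) :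
    fderiv ℝ (chartForm (fun y ↦ g.val y (X y)) x) (extChartAt (𝓡 D) x x) v u =
      dMetric g x v (chartVec x (X x)) u +
      chartMetric g x (extChartAt (𝓡 D) x x)
        (fderiv ℝ (chartField X x) (extChartAt (𝓡 D) x x) v) u := by
  have h : chartForm (fun y ↦ g.val y (X y)) x =ᶠ[nhds (extChartAt (𝓡 D) x x)]
      fun y ↦ chartMetric g x y (chartField X x y) := by
    filter_upwards [target_mem_nhds x] with y hy using chartForm_lower g X hy
  rw [h.fderiv_eq, fderiv_clm_apply (differentiableAt_chartMetric g x)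
    ((contDiffAt_chartField hX x).differentiableAt (by simp)), chartField_self]
  exact add_comm _ _

/-- Metric compatibility: differentiating `g(X, u)` in the chart gives `∂_v g(X,u) + g(∂_v X, u)`,
and the extra `∂_v g` turns the Christoffel term of the form into that of the field. This reduces
`κ` to Ricci rotation coefficients. -/
lemma val_covField {X : (x : M) → TangentSpace (𝓡 D) x} (hX : SmoothField X) (x : M)
    (v u : TangentSpace (𝓡 D) x) : g.val x (covField g X x v) u = ricciRot g X x u v := by
  rw [ricciRot_eq, fderiv_chartForm_lower g hX, ← chartMetric_self g x (covField g X x v) u,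
    chartVec_covField, map_add, add_apply, christoffel_spec, dMetric_symm g x (chartVec x v),
    dMetric_symm g x (chartVec x u)]
  ring

lemma differentiableAt_chartForm_lower {X : (x : M) → TangentSpace (𝓡 D) x} (hX : SmoothField X)
    (x : M) : DifferentiableAt ℝ (chartForm (fun y ↦ g.val y (X y)) x) (extChartAt (𝓡 D) x x) := by
  have h : chartForm (fun y ↦ g.val y (X y)) x =ᶠ[nhds (extChartAt (𝓡 D) x x)]
      fun y ↦ chartMetric g x y (chartField X x y) := by
    filter_upwards [target_mem_nhds x] with y hy using chartForm_lower g X hy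
  exact ((differentiableAt_chartMetric g x).clm_apply
    ((contDiffAt_chartField hX x).differentiableAt (by simp))).congr_of_eventuallyEq h

lemma mvfderiv_param {f : M → ℝ} (hf : ContMDiff (𝓡 D) 𝓘(ℝ, ℝ) ∞ f) {x : M} {y : Model D}
    (hy : y ∈ (extChartAt (𝓡 D) x).target) (v : Model D) :
    fderiv ℝ (fun y ↦ f (param x y)) y v = mvfderiv (𝓡 D) f (param x y) (paramDeriv x y v) := by
  have h1 : MDifferentiableAt (𝓡 D) 𝓘(ℝ, ℝ) f (param x y) := hf.mdifferentiableAt (by simp)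
  have h2 : MDifferentiableAt 𝓘(ℝ, Model D) (𝓡 D) (param x) y :=
    ((contMDiffOn_extChartAt_symm (n := ∞) x).contMDiffAt
      ((isOpen_extChartAt_target x).mem_nhds hy)).mdifferentiableAt (by simp)
  have h3 := mfderiv_comp y h1 h2
  rw [mfderiv_eq_fderiv] at h3
  exact congrArg (fun f : Model D →L[ℝ] ℝ ↦ f v) h3

lemma diff_eq {f : M → ℝ} (hf : ContMDiff (𝓡 D) 𝓘(ℝ, ℝ) ∞ f) (x : M) (v : TangentSpace (𝓡 D) x) :
    diff f x v = fderiv ℝ (fun y ↦ f (param x y)) (extChartAt (𝓡 D) x x) (chartVec x v) := by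
  rw [mvfderiv_param hf (mem_extChartAt_target x)]
  have h : ∀ x' : M, x' = x → ∀ v : Model D, diff f x v = mvfderiv (𝓡 D) f x' v := by
    rintro _ rfl _; rfl
  change _ = mvfderiv (𝓡 D) f _ (paramD x (extChartAt (𝓡 D) x x) (chartVec x v))
  rw [paramD_self, chartVec_eq]
  exact h _ (param_extChartAt_self x) v

end Chart

/-! ### The Koszul expression of a Kaluza–Klein metric in a vector space -/

section Calculus

variable {E F : Type*} [NormedAddCommGroup E] [NormedSpace ℝ E] [NormedAddCommGroup F]
  [NormedSpace ℝ F]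

lemma fderiv_exp_comp {P : E → F} {f : F → ℝ} {y : E} (hP : DifferentiableAt ℝ P y)
    (hf : DifferentiableAt ℝ f (P y)) (k : ℝ) (w : E) :
    DifferentiableAt ℝ (fun y ↦ Real.exp (k * f (P y))) y ∧
    fderiv ℝ (fun y ↦ Real.exp (k * f (P y))) y w =
      k * Real.exp (k * f (P y)) * fderiv ℝ f (P y) (fderiv ℝ P y w) := by
  have h := ((hf.hasFDerivAt.comp y hP.hasFDerivAt).const_mul k).exp
  refine ⟨h.differentiableAt, ?_⟩
  rw [show (fun y ↦ Real.exp (k * f (P y))) = fun y ↦ Real.exp (k * (f ∘ P) y) from rfl, h.fderiv]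
  simp
  ring

/-- The values lie in an arbitrary `H` so that the lemma also covers a bilinear form with its second
slot left open. -/
lemma fderiv_pullback_form {H : Type*} [NormedAddCommGroup H] [NormedSpace ℝ H] {P : E → F}
    {θ : F → F →L[ℝ] H} {y : E} (hP : ContDiffAt ℝ 2 P y)
    (hθ : DifferentiableAt ℝ θ (P y)) (u w : E) :
    DifferentiableAt ℝ (fun y ↦ θ (P y) (fderiv ℝ P y u)) y ∧
    fderiv ℝ (fun y ↦ θ (P y) (fderiv ℝ P y u)) y w =
      fderiv ℝ θ (P y) (fderiv ℝ P y w) (fderiv ℝ P y u) +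
      θ (P y) (fderiv ℝ (fderiv ℝ P) y w u) := by
  have h1 : DifferentiableAt ℝ P y := hP.differentiableAt (by simp)
  have h2 : DifferentiableAt ℝ (fderiv ℝ P) y :=
    (hP.fderiv_right (m := 1) (by norm_num)).differentiableAt (by simp)
  have h := (hθ.hasFDerivAt.comp y h1.hasFDerivAt).clm_apply
    (h2.hasFDerivAt.clm_apply (hasFDerivAt_const u y))
  refine ⟨h.differentiableAt, ?_⟩
  rw [show (fun y ↦ θ (P y) (fderiv ℝ P y u)) = fun y ↦ (θ ∘ P) y (fderiv ℝ P y u) from rfl,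
    h.fderiv]
  simp [add_comm]

lemma fderiv_pullback_bilin {P : E → F} {G : F → F →L[ℝ] F →L[ℝ] ℝ} {y : E}
    (hP : ContDiffAt ℝ 2 P y) (hG : DifferentiableAt ℝ G (P y)) (u v w : E) :
    DifferentiableAt ℝ (fun y ↦ G (P y) (fderiv ℝ P y u) (fderiv ℝ P y v)) y ∧
    fderiv ℝ (fun y ↦ G (P y) (fderiv ℝ P y u) (fderiv ℝ P y v)) y w =
      fderiv ℝ G (P y) (fderiv ℝ P y w) (fderiv ℝ P y u) (fderiv ℝ P y v) +
      G (P y) (fderiv ℝ (fderiv ℝ P) y w u) (fderiv ℝ P y v) +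
      G (P y) (fderiv ℝ P y u) (fderiv ℝ (fderiv ℝ P) y w v) := by
  have h2 : DifferentiableAt ℝ (fderiv ℝ P) y :=
    (hP.fderiv_right (m := 1) (by norm_num)).differentiableAt (by simp)
  have h3 : DifferentiableAt ℝ (fun y ↦ fderiv ℝ P y v) y := h2.clm_apply (differentiableAt_const v)
  obtain ⟨h4, h5⟩ := fderiv_pullback_form hP hG u w
  refine ⟨h4.clm_apply h3, ?_⟩
  rw [fderiv_clm_apply h4 h3, fderiv_clm_apply h2 (differentiableAt_const v)]
  simp only [add_apply, ContinuousLinearMap.comp_apply, ContinuousLinearMap.flip_apply, h5]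
  simp
  ring

lemma fderiv_gauge_form {P : E → F} {ζ : E → ℝ} {A : F → F →L[ℝ] ℝ} {y : E}
    (hP : ContDiffAt ℝ 2 P y) (hζ : ContDiffAt ℝ 2 ζ y) (hA : DifferentiableAt ℝ A (P y))
    (u w : E) :
    DifferentiableAt ℝ (fun y ↦ fderiv ℝ ζ y u + A (P y) (fderiv ℝ P y u)) y ∧
    fderiv ℝ (fun y ↦ fderiv ℝ ζ y u + A (P y) (fderiv ℝ P y u)) y w =
      fderiv ℝ (fderiv ℝ ζ) y w u +
      (fderiv ℝ A (P y) (fderiv ℝ P y w) (fderiv ℝ P y u) +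
        A (P y) (fderiv ℝ (fderiv ℝ P) y w u)) := by
  have h2 : DifferentiableAt ℝ (fderiv ℝ ζ) y :=
    (hζ.fderiv_right (m := 1) (by norm_num)).differentiableAt (by simp)
  obtain ⟨h3, h4⟩ := fderiv_pullback_form hP hA u w
  have h5 : DifferentiableAt ℝ (fun y ↦ fderiv ℝ ζ y u) y := h2.clm_apply (differentiableAt_const u)
  refine ⟨h5.add h3, ?_⟩
  rw [fderiv_fun_add h5 h3, add_apply, h4, fderiv_clm_apply h2 (differentiableAt_const u)]
  simp

variable (P : E → F) (ζ : E → ℝ) (G : F → F →L[ℝ] F →L[ℝ] ℝ) (A θ : F → F →L[ℝ] ℝ) (f : F → ℝ)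
  (α β : ℝ)

/-- The form `dz + A`. -/
def gaugeForm (u y : E) : ℝ := fderiv ℝ ζ y u + A (P y) (fderiv ℝ P y u)

/-- The metric `e^{2αf} G + e^{2βf} (dζ + A)²`. -/
def kkMetric (u v y : E) : ℝ :=
  Real.exp (2 * α * f (P y)) * G (P y) (fderiv ℝ P y u) (fderiv ℝ P y v) +
    Real.exp (2 * β * f (P y)) * (gaugeForm P ζ A u y * gaugeForm P ζ A v y)

/-- The form `e^{αf} θ`. -/
def kkForm (u y : E) : ℝ := Real.exp (α * f (P y)) * θ (P y) (fderiv ℝ P y u)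

variable {P ζ G A θ f α β}

lemma fderiv_kkForm {y : E} (hP : ContDiffAt ℝ 2 P y) (hθ : DifferentiableAt ℝ θ (P y))
    (hf : DifferentiableAt ℝ f (P y)) (u w : E) :
    fderiv ℝ (kkForm P θ f α u) y w = Real.exp (α * f (P y)) *
      (fderiv ℝ θ (P y) (fderiv ℝ P y w) (fderiv ℝ P y u) +
        θ (P y) (fderiv ℝ (fderiv ℝ P) y w u) +
        α * fderiv ℝ f (P y) (fderiv ℝ P y w) * θ (P y) (fderiv ℝ P y u)) := by
  obtain ⟨h1, h2⟩ := fderiv_exp_comp (hP.differentiableAt (by simp)) hf α w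
  obtain ⟨h3, h4⟩ := fderiv_pullback_form hP hθ u w
  unfold kkForm
  rw [fderiv_fun_mul h1 h3]
  simp only [add_apply, smul_apply, smul_eq_mul]
  rw [h2, h4]
  ring

lemma fderiv_kkMetric {y : E} (hP : ContDiffAt ℝ 2 P y) (hζ : ContDiffAt ℝ 2 ζ y)
    (hG : DifferentiableAt ℝ G (P y)) (hA : DifferentiableAt ℝ A (P y))
    (hf : DifferentiableAt ℝ f (P y)) (u v w : E) :
    fderiv ℝ (kkMetric P ζ G A f α β u v) y w = Real.exp (2 * α * f (P y)) *
        (fderiv ℝ G (P y) (fderiv ℝ P y w) (fderiv ℝ P y u) (fderiv ℝ P y v) +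
        G (P y) (fderiv ℝ (fderiv ℝ P) y w u) (fderiv ℝ P y v) +
        G (P y) (fderiv ℝ P y u) (fderiv ℝ (fderiv ℝ P) y w v) +
        2 * α * fderiv ℝ f (P y) (fderiv ℝ P y w) * G (P y) (fderiv ℝ P y u) (fderiv ℝ P y v)) +
      Real.exp (2 * β * f (P y)) * (gaugeForm P ζ A u y * (fderiv ℝ (fderiv ℝ ζ) y w v +
          (fderiv ℝ A (P y) (fderiv ℝ P y w) (fderiv ℝ P y v) +
            A (P y) (fderiv ℝ (fderiv ℝ P) y w v))) +
        gaugeForm P ζ A v y * (fderiv ℝ (fderiv ℝ ζ) y w u +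
          (fderiv ℝ A (P y) (fderiv ℝ P y w) (fderiv ℝ P y u) +
            A (P y) (fderiv ℝ (fderiv ℝ P) y w u))) +
        2 * β * fderiv ℝ f (P y) (fderiv ℝ P y w) *
          (gaugeForm P ζ A u y * gaugeForm P ζ A v y)) := by
  obtain ⟨h1, h2⟩ := fderiv_exp_comp (hP.differentiableAt (by simp)) hf (2 * α) w
  obtain ⟨h1', h2'⟩ := fderiv_exp_comp (hP.differentiableAt (by simp)) hf (2 * β) w
  obtain ⟨h3, h4⟩ := fderiv_pullback_bilin hP hG u v w
  obtain ⟨h5, h6⟩ := fderiv_gauge_form hP hζ hA u w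
  obtain ⟨h7, h8⟩ := fderiv_gauge_form hP hζ hA v w
  unfold kkMetric gaugeForm
  rw [fderiv_fun_add (h1.fun_mul h3) (h1'.fun_mul (h5.fun_mul h7)), fderiv_fun_mul h1 h3,
    fderiv_fun_mul h1' (h5.fun_mul h7), fderiv_fun_mul h5 h7]
  simp only [add_apply, smul_apply, smul_eq_mul]
  rw [h2, h4, h2', h6, h8]
  ring

set_option synthInstance.maxHeartbeats 200000 in
/-- The Koszul form of the covariant derivative of a lifted null field. -/
lemma kk_koszul {y : E} (hP : ContDiffAt ℝ 2 P y) (hζ : ContDiffAt ℝ 2 ζ y)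
    (hG : DifferentiableAt ℝ G (P y)) (hA : DifferentiableAt ℝ A (P y))
    (hθ : DifferentiableAt ℝ θ (P y)) (hf : DifferentiableAt ℝ f (P y))
    (hGsymm : ∀ a b, G (P y) a b = G (P y) b a) {X : F} {Xh : E} (hX : ∀ a, θ (P y) a = G (P y) X a)
    (hXh : fderiv ℝ P y Xh = Real.exp (-α * f (P y)) • X) (hη : gaugeForm P ζ A Xh y = 0)
    (u v : E) :
    fderiv ℝ (kkForm P θ f α u) y v -
      1 / 2 * (fderiv ℝ (kkMetric P ζ G A f α β u Xh) y v +
        fderiv ℝ (kkMetric P ζ G A f α β v Xh) y u -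
        fderiv ℝ (kkMetric P ζ G A f α β v u) y Xh) =
    Real.exp (α * f (P y)) *
      (fderiv ℝ θ (P y) (fderiv ℝ P y v) (fderiv ℝ P y u) -
        1 / 2 * (fderiv ℝ G (P y) (fderiv ℝ P y v) (fderiv ℝ P y u) X +
          fderiv ℝ G (P y) (fderiv ℝ P y u) (fderiv ℝ P y v) X -
          fderiv ℝ G (P y) X (fderiv ℝ P y v) (fderiv ℝ P y u)) -
        α * fderiv ℝ f (P y) (fderiv ℝ P y u) * G (P y) X (fderiv ℝ P y v) +
        α * fderiv ℝ f (P y) X * G (P y) (fderiv ℝ P y u) (fderiv ℝ P y v)) +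
    1 / 2 * (Real.exp (-α * f (P y)) * Real.exp (2 * β * f (P y))) *
      (gaugeForm P ζ A u y * (fderiv ℝ A (P y) X (fderiv ℝ P y v) -
          fderiv ℝ A (P y) (fderiv ℝ P y v) X) +
        gaugeForm P ζ A v y * (fderiv ℝ A (P y) X (fderiv ℝ P y u) -
          fderiv ℝ A (P y) (fderiv ℝ P y u) X) +
        2 * β * fderiv ℝ f (P y) X * (gaugeForm P ζ A u y * gaugeForm P ζ A v y)) := by
  -- Symmetry of second derivatives cancels all terms that pair `D²P` or `D²ζ` with `Xh`. The
  -- `D²ζ(v,u)` term carries the factor `gaugeForm … Xh = 0`, and `G(D²P(v,u), X)` cancels against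
  -- `θ(D²P(v,u))` from the lowered field.
  have hPs : ∀ a b, fderiv ℝ (fderiv ℝ P) y a b = fderiv ℝ (fderiv ℝ P) y b a :=
    fun a b ↦ (hP.isSymmSndFDerivAt (by simp)).eq a b
  have hζs : ∀ a b, fderiv ℝ (fderiv ℝ ζ) y a b = fderiv ℝ (fderiv ℝ ζ) y b a :=
    fun a b ↦ (hζ.isSymmSndFDerivAt (by simp)).eq a b
  rw [fderiv_kkForm hP hθ hf, fderiv_kkMetric hP hζ hG hA hf, fderiv_kkMetric hP hζ hG hA hf,
    fderiv_kkMetric hP hζ hG hA hf, hη, hXh, hPs Xh u, hPs Xh v, hζs Xh u, hζs Xh v, hPs u v, hX,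
    hX]
  simp only [map_smul, smul_apply, smul_eq_mul]
  have s1 : ∀ a, G (P y) a X = G (P y) X a := fun a ↦ hGsymm a X
  have s2 := hGsymm (fderiv ℝ P y v) (fderiv ℝ P y u)
  have s3 : ∀ w, G (P y) (fderiv ℝ (fderiv ℝ P) y w Xh) (fderiv ℝ P y u) =
    G (P y) (fderiv ℝ P y u) (fderiv ℝ (fderiv ℝ P) y w Xh) := fun w ↦ hGsymm _ _
  simp only [s1, s2, s3]
  have e1 : Real.exp (2 * α * f (P y)) = Real.exp (α * f (P y)) ^ 2 := by
    rw [← Real.exp_nat_mul]; ring_nf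
  have e2 : Real.exp (α * f (P y)) * Real.exp (-α * f (P y)) = 1 := by
    rw [← Real.exp_add]; simp
  rw [e1]
  generalize Real.exp (α * f (P y)) = c at *
  generalize Real.exp (-α * f (P y)) = d at *
  -- The metric contributes `e^{2αf}` and the vector `Xh` contributes `e^{-αf}`; together they match
  -- the factor `e^{αf}` of the lowered field. The coefficient below collects exactly the terms
  -- carrying this product.
  have e3 : c ^ 2 * d = c := by linear_combination c * e2
  linear_combination (-1 / 2 : ℝ) *
    (fderiv ℝ G (P y) (fderiv ℝ P y v) (fderiv ℝ P y u) X +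
      fderiv ℝ G (P y) (fderiv ℝ P y u) (fderiv ℝ P y v) X -
      fderiv ℝ G (P y) X (fderiv ℝ P y v) (fderiv ℝ P y u) +
      2 * G (P y) X (fderiv ℝ (fderiv ℝ P) y v u) +
      2 * α * fderiv ℝ f (P y) (fderiv ℝ P y v) * G (P y) X (fderiv ℝ P y u) +
      2 * α * fderiv ℝ f (P y) (fderiv ℝ P y u) * G (P y) X (fderiv ℝ P y v) -
      2 * α * fderiv ℝ f (P y) X * G (P y) (fderiv ℝ P y u) (fderiv ℝ P y v)) * e3

end Calculus

/-! ### The reduction in the charts at `p` and at its projection -/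

section Reduction

variable {D : ℕ} {M : Type*} [TopologicalSpace M] [ChartedSpace (Model D) M]
  [IsManifold (𝓡 D) ∞ M]
  {N : Type*} [TopologicalSpace N] [ChartedSpace (Model (D + 1)) N]
  [IsManifold (𝓡 (D + 1)) ∞ N]

lemma chartField_extChartAt (X : (x : M) → TangentSpace (𝓡 D) x) {x x' : M}
    (h : x' ∈ (extChartAt (𝓡 D) x).source) :
    chartField X x (extChartAt (𝓡 D) x x') = chartD x x' (X x') := by
  rw [chartField_eq X ((extChartAt (𝓡 D) x).map_source h), param_extChartAt h]

namespace Reduction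

variable {α β : ℝ} {g : LorentzianMetric D M} {gh : LorentzianMetric (D + 1) N}
  (K : Reduction α β g gh)

/-- The differential of the projection. -/
abbrev dproj (p : N) : TangentSpace (𝓡 (D + 1)) p →L[ℝ] TangentSpace (𝓡 D) (K.proj p) :=
  mfderiv (𝓡 (D + 1)) (𝓡 D) K.proj p

/-- The projection in the charts at `p` and `K.proj p`. -/
def chartProj (p : N) (y : Model (D + 1)) : Model D :=
  extChartAt (𝓡 D) (K.proj p) (K.proj (param p y))

/-- The coordinate `z` in the chart at `p`. -/
def chartZ (p : N) (y : Model (D + 1)) : ℝ := K.z (param p y)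

/-- The scalar field in the chart at `K.proj p`. -/
def chartφ (p : N) (y : Model D) : ℝ := K.φ (param (K.proj p) y)

/-- The gauge form `dz + A` on `N`. -/
def gauge (p : N) (u : TangentSpace (𝓡 (D + 1)) p) : ℝ :=
  mvfderiv (𝓡 (D + 1)) K.z p u + K.A (K.proj p) (K.dproj p u)

lemma eventually_mem_charts (p : N) : ∀ᶠ y in nhds (extChartAt (𝓡 (D + 1)) p p),
    y ∈ (extChartAt (𝓡 (D + 1)) p).target ∧
      K.proj (param p y) ∈ (extChartAt (𝓡 D) (K.proj p)).source := by
  refine Filter.Eventually.and (target_mem_nhds p) ?_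
  have h1 : ContinuousAt (fun y ↦ K.proj (param p y)) (extChartAt (𝓡 (D + 1)) p p) :=
    K.smooth_proj.continuous.continuousAt.comp (contMDiffAt_param p).continuousAt
  apply h1
  beta_reduce
  rw [param_extChartAt_self]
  exact extChartAt_source_mem_nhds _

lemma chartProj_self (p : N) :
    K.chartProj p (extChartAt (𝓡 (D + 1)) p p) = extChartAt (𝓡 D) (K.proj p) (K.proj p) := by
  rw [chartProj, param_extChartAt_self]

lemma contDiffAt_chartProj (p : N) :
    ContDiffAt ℝ ∞ (K.chartProj p) (extChartAt (𝓡 (D + 1)) p p) := by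
  apply contDiffAt_comp_param (f := fun q ↦ extChartAt (𝓡 D) (K.proj p) (K.proj q))
  exact ContMDiffAt.comp p (contMDiffAt_extChartAt (I := 𝓡 D) (n := ∞)) (K.smooth_proj p)

lemma contDiffAt_chartZ (p : N) :
    ContDiffAt ℝ ∞ (K.chartZ p) (extChartAt (𝓡 (D + 1)) p p) :=
  contDiffAt_comp_param (K.smooth_z p)

lemma contDiffAt_chartφ (p : N) :
    ContDiffAt ℝ ∞ (K.chartφ p) (extChartAt (𝓡 D) (K.proj p) (K.proj p)) :=
  contDiffAt_comp_param (K.smooth_φ _)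

variable {K}

lemma fderiv_chartProj {p : N} {y : Model (D + 1)}
    (hy : y ∈ (extChartAt (𝓡 (D + 1)) p).target ∧
      K.proj (param p y) ∈ (extChartAt (𝓡 D) (K.proj p)).source) (u : Model (D + 1)) :
    fderiv ℝ (K.chartProj p) y u =
      chartD (K.proj p) (K.proj (param p y)) (K.dproj (param p y) (paramDeriv p y u)) := by
  have h1 : MDifferentiableAt (𝓡 (D + 1)) (𝓡 D) K.proj (param p y) :=
    K.smooth_proj.mdifferentiableAt (by simp)
  have h2 : MDifferentiableAt 𝓘(ℝ, Model (D + 1)) (𝓡 (D + 1)) (param p) y :=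
    ((contMDiffOn_extChartAt_symm (n := ∞) p).contMDiffAt
      ((isOpen_extChartAt_target p).mem_nhds hy.1)).mdifferentiableAt (by simp)
  have h3 : MDifferentiableAt (𝓡 D) 𝓘(ℝ, Model D) (extChartAt (𝓡 D) (K.proj p))
      (K.proj (param p y)) := mdifferentiableAt_extChartAt (by simpa using hy.2)
  have h4 := mfderiv_comp y h3 (h1.comp y h2)
  rw [mfderiv_comp y h1 h2, mfderiv_eq_fderiv] at h4
  exact congrArg (fun f : Model (D + 1) →L[ℝ] Model D ↦ f u) h4

lemma chartφ_chartProj {p : N} {y : Model (D + 1)}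
    (hy : K.proj (param p y) ∈ (extChartAt (𝓡 D) (K.proj p)).source) :
    K.chartφ p (K.chartProj p y) = K.φ (K.proj (param p y)) := by
  rw [chartφ, chartProj, param_extChartAt hy]

lemma gaugeForm_chart {p : N} {y : Model (D + 1)}
    (hy : y ∈ (extChartAt (𝓡 (D + 1)) p).target ∧
      K.proj (param p y) ∈ (extChartAt (𝓡 D) (K.proj p)).source) (u : Model (D + 1)) :
    gaugeForm (K.chartProj p) (K.chartZ p) (chartForm K.A (K.proj p)) u y =
      K.gauge (param p y) (paramDeriv p y u) := by
  unfold gaugeForm gauge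
  rw [fderiv_chartProj hy]
  have h1 := mvfderiv_param K.smooth_z hy.1 u
  have h2 := chartForm_extChartAt K.A hy.2 (K.dproj (param p y) (paramDeriv p y u))
  exact congrArg₂ (· + ·) h1 h2

lemma chartMetric_eq {p : N} {y : Model (D + 1)}
    (hy : y ∈ (extChartAt (𝓡 (D + 1)) p).target ∧
      K.proj (param p y) ∈ (extChartAt (𝓡 D) (K.proj p)).source) (u v : Model (D + 1)) :
    chartMetric gh p y u v = kkMetric (K.chartProj p) (K.chartZ p) (chartMetric g (K.proj p))
      (chartForm K.A (K.proj p)) (K.chartφ p) α β u v y := by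
  unfold kkMetric
  rw [gaugeForm_chart hy, gaugeForm_chart hy, chartφ_chartProj hy.2, fderiv_chartProj hy,
    fderiv_chartProj hy, chartMetric_apply, K.metric_eq]
  have h2 := chartMetric_extChartAt g hy.2 (K.dproj (param p y) (paramDeriv p y u))
    (K.dproj (param p y) (paramDeriv p y v))
  exact congrArg (fun t ↦ Real.exp (2 * α * K.φ (K.proj (param p y))) * t + _) h2.symm

lemma dproj_delZ (p : N) : K.dproj p (K.delZ p) = 0 :=
  congrArg Prod.fst ((K.split p).apply_symm_apply (0, 1))

lemma dz_delZ (p : N) : mvfderiv (𝓡 (D + 1)) K.z p (K.delZ p) = 1 :=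
  congrArg Prod.snd ((K.split p).apply_symm_apply (0, 1))

lemma dproj_push (p : N) (v : TangentSpace (𝓡 D) (K.proj p)) : K.dproj p (K.push p v) = v :=
  congrArg Prod.fst ((K.split p).apply_symm_apply (v, 0))

lemma dz_push (p : N) (v : TangentSpace (𝓡 D) (K.proj p)) :
    mvfderiv (𝓡 (D + 1)) K.z p (K.push p v) = 0 :=
  congrArg Prod.snd ((K.split p).apply_symm_apply (v, 0))

lemma dproj_lift (p : N) (v : TangentSpace (𝓡 D) (K.proj p)) :
    K.dproj p (K.lift p v) = Real.exp (-α * K.φ (K.proj p)) • v := by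
  rw [lift, map_smul, map_sub, map_smul, dproj_delZ, dproj_push, smul_zero, sub_zero]

lemma dz_lift (p : N) (v : TangentSpace (𝓡 D) (K.proj p)) :
    mvfderiv (𝓡 (D + 1)) K.z p (K.lift p v) =
      -(Real.exp (-α * K.φ (K.proj p)) * K.A (K.proj p) v) := by
  rw [lift, map_smul, map_sub, map_smul, dz_delZ, dz_push]
  simp

lemma gauge_lift (p : N) (v : TangentSpace (𝓡 D) (K.proj p)) : K.gauge p (K.lift p v) = 0 := by
  rw [gauge, dz_lift, dproj_lift, map_smul, smul_eq_mul]
  ring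

lemma dproj_liftZ (p : N) : K.dproj p (K.liftZ p) = 0 := by
  rw [liftZ, map_smul, dproj_delZ, smul_zero]

lemma gauge_liftZ (p : N) : K.gauge p (K.liftZ p) = Real.exp (-β * K.φ (K.proj p)) := by
  rw [gauge, dproj_liftZ, liftZ, map_smul, dz_delZ]
  simp

lemma val_eq (p : N) (u v : TangentSpace (𝓡 (D + 1)) p) :
    gh.val p u v = Real.exp (2 * α * K.φ (K.proj p)) * g.val (K.proj p) (K.dproj p u) (K.dproj p v) +
      Real.exp (2 * β * K.φ (K.proj p)) * (K.gauge p u * K.gauge p v) :=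
  K.metric_eq p u v

/-- The gauge form kills the lift, so only `e^{2αφ} g` contributes, and one factor `e^{-αφ}` comes
from the lift. Lowering the lifted field thus gives `e^{αφ}` times the pullback of the lowered
field. -/
lemma val_lift_left (p : N) (v : TangentSpace (𝓡 D) (K.proj p)) (u : TangentSpace (𝓡 (D + 1)) p) :
    gh.val p (K.lift p v) u =
      Real.exp (α * K.φ (K.proj p)) * g.val (K.proj p) v (K.dproj p u) := by
  rw [K.val_eq, gauge_lift, dproj_lift, map_smul, smul_apply, smul_eq_mul, ← mul_assoc,
    ← Real.exp_add]
  ring_nf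

lemma chartForm_liftField (l : (x : M) → TangentSpace (𝓡 D) x) {p : N} {y : Model (D + 1)}
    (hy : y ∈ (extChartAt (𝓡 (D + 1)) p).target ∧
      K.proj (param p y) ∈ (extChartAt (𝓡 D) (K.proj p)).source) (u : Model (D + 1)) :
    chartForm (fun q ↦ gh.val q (K.liftField l q)) p y u =
      kkForm (K.chartProj p) (chartForm (fun x ↦ g.val x (l x)) (K.proj p)) (K.chartφ p) α u y := by
  unfold kkForm
  rw [chartφ_chartProj hy.2, fderiv_chartProj hy]
  have h2 := chartForm_extChartAt (fun x ↦ g.val x (l x)) hy.2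
    (K.dproj (param p y) (paramDeriv p y u))
  exact (K.val_lift_left (param p y) _ _).trans
    (congrArg (fun t ↦ Real.exp (α * K.φ (K.proj (param p y))) * t) h2.symm)

end Reduction

end Reduction

/-! ### Differentials at the base point and smoothness of the lifted field -/

section Reduction

variable {D : ℕ} {M : Type*} [TopologicalSpace M] [ChartedSpace (Model D) M]
  [IsManifold (𝓡 D) ∞ M]
  {N : Type*} [TopologicalSpace N] [ChartedSpace (Model (D + 1)) N]
  [IsManifold (𝓡 (D + 1)) ∞ N]

omit [IsManifold (𝓡 D) ∞ M] [IsManifold (𝓡 (D + 1)) ∞ N] in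
lemma mem_charts_self (p : N) (proj : N → M) : extChartAt (𝓡 (D + 1)) p p ∈
    (extChartAt (𝓡 (D + 1)) p).target ∧
      proj (param p (extChartAt (𝓡 (D + 1)) p p)) ∈ (extChartAt (𝓡 D) (proj p)).source := by
  rw [param_extChartAt_self]
  exact ⟨mem_extChartAt_target p, mem_extChartAt_source _⟩

namespace Reduction

variable {α β : ℝ} {g : LorentzianMetric D M} {gh : LorentzianMetric (D + 1) N}
  {K : Reduction α β g gh}

lemma fderiv_chartProj_self (p : N) (u : TangentSpace (𝓡 (D + 1)) p) :
    fderiv ℝ (K.chartProj p) (extChartAt (𝓡 (D + 1)) p p) (chartVec p u) =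
      chartVec (K.proj p) (K.dproj p u) := by
  rw [fderiv_chartProj (mem_charts_self p K.proj)]
  have h : ∀ q : N, q = p → ∀ w : Model (D + 1),
      chartD (K.proj p) (K.proj q) (K.dproj q w) = chartVec (K.proj p) (K.dproj p w) := by
    rintro _ rfl _; rfl
  refine (h _ (param_extChartAt_self p) (paramD p (extChartAt (𝓡 (D + 1)) p p) (chartVec p u))).trans
    ?_
  rw [paramD_self, chartVec_eq p u]
  rfl

lemma gaugeForm_chart_self (p : N) (u : TangentSpace (𝓡 (D + 1)) p) :
    gaugeForm (K.chartProj p) (K.chartZ p) (chartForm K.A (K.proj p)) (chartVec p u)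
      (extChartAt (𝓡 (D + 1)) p p) = K.gauge p u := by
  rw [gaugeForm_chart (mem_charts_self p K.proj)]
  have h : ∀ q : N, q = p → ∀ w : Model (D + 1), K.gauge q w = K.gauge p w := by
    rintro _ rfl _; rfl
  refine (h _ (param_extChartAt_self p) (paramD p (extChartAt (𝓡 (D + 1)) p p) (chartVec p u))).trans
    ?_
  rw [paramD_self, chartVec_eq p u]
  rfl

lemma dMetric_eq (p : N) (w u v : Model (D + 1)) :
    dMetric gh p w u v = fderiv ℝ (kkMetric (K.chartProj p) (K.chartZ p)
      (chartMetric g (K.proj p)) (chartForm K.A (K.proj p)) (K.chartφ p) α β u v)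
      (extChartAt (𝓡 (D + 1)) p p) w := by
  rw [dMetric, ← fderiv_bilin_apply (differentiableAt_chartMetric gh p)]
  have h : (fun y ↦ chartMetric gh p y u v) =ᶠ[nhds (extChartAt (𝓡 (D + 1)) p p)]
      kkMetric (K.chartProj p) (K.chartZ p)
        (chartMetric g (K.proj p)) (chartForm K.A (K.proj p)) (K.chartφ p) α β u v := by
    filter_upwards [K.eventually_mem_charts p] with y hy using chartMetric_eq hy u v
  rw [h.fderiv_eq]

/-- The bijectivity of `(dπ, dz)` written in charts; it allows a vector field upstairs to be
recovered smoothly from its two parts. -/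
lemma isInvertible_split (p : N) :
    ((fderiv ℝ (K.chartProj p) (extChartAt (𝓡 (D + 1)) p p)).prod
      (fderiv ℝ (K.chartZ p) (extChartAt (𝓡 (D + 1)) p p))).IsInvertible := by
  set S := (fderiv ℝ (K.chartProj p) (extChartAt (𝓡 (D + 1)) p p)).prod
      (fderiv ℝ (K.chartZ p) (extChartAt (𝓡 (D + 1)) p p))
  have hS : ∀ u : TangentSpace (𝓡 (D + 1)) p, S (chartVec p u) =
      (chartVec (K.proj p) (K.dproj p u), mvfderiv (𝓡 (D + 1)) K.z p u) := by
    intro u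
    refine Prod.ext (fderiv_chartProj_self p u) ?_
    exact (diff_eq K.smooth_z p u).symm
  have hinj : Function.Injective S.toLinearMap := by
    rw [injective_iff_map_eq_zero]
    intro w hw
    obtain ⟨u, rfl⟩ : ∃ u : TangentSpace (𝓡 (D + 1)) p, chartVec p u = w := ⟨w, chartVec_eq p w⟩
    have h1 := (hS u).symm.trans hw
    have h2 : K.split p u = 0 := by
      refine Prod.ext ?_ (congrArg Prod.snd h1 : mvfderiv (𝓡 (D + 1)) K.z p u = 0)
      have h3 := congrArg Prod.fst h1
      simp only at h3
      rw [chartVec_eq] at h3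
      exact h3
    rw [(K.split p).map_eq_zero_iff.1 h2]
    exact map_zero (mfderiv (𝓡 (D + 1)) 𝓘(ℝ, Model (D + 1)) (extChartAt (𝓡 (D + 1)) p) p)
  have hd : Module.finrank ℝ (Model (D + 1)) = Module.finrank ℝ (Model D × ℝ) := by
    simp
  let e := LinearEquiv.ofInjectiveOfFinrankEq S.toLinearMap hinj hd
  exact ⟨e.toContinuousLinearEquiv, by ext <;> rfl⟩

lemma comp_chartProj {F : Type*} [NormedAddCommGroup F] [NormedSpace ℝ F] {f : Model D → F} {p : N}
    (hf : ContDiffAt ℝ ∞ f (extChartAt (𝓡 D) (K.proj p) (K.proj p))) :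
    ContDiffAt ℝ ∞ (fun y ↦ f (K.chartProj p y)) (extChartAt (𝓡 (D + 1)) p p) := by
  rw [← chartProj_self K p] at hf
  exact hf.comp _ (K.contDiffAt_chartProj p)

/-- The components of the lift solve the linear system `S y · = w y`, where `S = (dP, dζ)` and `w`
holds the prescribed `dπ` and `dz` parts. Both are smooth, and inversion is smooth at an invertible
operator. -/
lemma smoothField_liftField {l : (x : M) → TangentSpace (𝓡 D) x} (hl : SmoothField l) :
    SmoothField (K.liftField l) := by
  intro p
  rw [contMDiffAt_section_iff]
  set y₀ := extChartAt (𝓡 (D + 1)) p p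
  let S : Model (D + 1) → Model (D + 1) →L[ℝ] Model D × ℝ := fun y ↦
    (fderiv ℝ (K.chartProj p) y).prod (fderiv ℝ (K.chartZ p) y)
  let lc : Model (D + 1) → Model D := fun y ↦ chartField l (K.proj p) (K.chartProj p y)
  let w : Model (D + 1) → Model D × ℝ := fun y ↦
    Real.exp (-α * K.chartφ p (K.chartProj p y)) •
      (lc y, -chartForm K.A (K.proj p) (K.chartProj p y) (lc y))
  have hP := K.contDiffAt_chartProj p
  have hS : ContDiffAt ℝ ∞ S y₀ :=
    contDiffAt_clm_apply_iff.2 fun _ ↦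
      ((hP.fderiv_right (m := ∞) (by simp)).clm_apply contDiffAt_const).prodMk
        (((K.contDiffAt_chartZ p).fderiv_right (m := ∞) (by simp)).clm_apply contDiffAt_const)
  have hlc : ContDiffAt ℝ ∞ lc y₀ :=
    comp_chartProj (contDiffAt_chartField hl (K.proj p))
  have hA : ContDiffAt ℝ ∞ (fun y ↦ chartForm K.A (K.proj p) (K.chartProj p y)) y₀ :=
    comp_chartProj (contDiffAt_chartForm K.smooth_A (K.proj p))
  have hφ : ContDiffAt ℝ ∞ (fun y ↦ K.chartφ p (K.chartProj p y)) y₀ :=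
    comp_chartProj (K.contDiffAt_chartφ p)
  have hw : ContDiffAt ℝ ∞ w y₀ :=
    (contDiffAt_const.mul hφ).exp.smul (hlc.prodMk (hA.clm_apply hlc).neg)
  obtain ⟨e, he⟩ := K.isInvertible_split p
  have hinv : ContDiffAt ℝ ∞ (fun y ↦ (S y).inverse (w y)) y₀ := by
    refine ContDiffAt.clm_apply ?_ hw
    refine ContDiffAt.comp (g := ContinuousLinearMap.inverse) y₀ ?_ hS
    exact ContinuousLinearMap.IsInvertible.contDiffAt_map_inverse (K.isInvertible_split p)
  refine hinv.congr_of_eventuallyEq ?_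
  -- Invertible operators form an open set, so the system is uniquely solvable near `y₀` and not
  -- only at it.
  have hev : ∀ᶠ y in nhds y₀, S y ∈ range ((↑) : (Model (D + 1) ≃L[ℝ] Model D × ℝ) →
      Model (D + 1) →L[ℝ] Model D × ℝ) := by
    apply hS.continuousAt
    rw [show S y₀ = _ from he.symm]
    exact ContinuousLinearEquiv.nhds e
  filter_upwards [hev, K.eventually_mem_charts p] with y hy hy'
  obtain ⟨e', he'⟩ := hy
  rw [← he', ContinuousLinearMap.inverse_equiv]
  symm
  refine (ContinuousLinearEquiv.symm_apply_eq e').2 ?_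
  have h0 : e' (chartField (K.liftField l) p y) = S y (chartField (K.liftField l) p y) := by
    rw [← he']; rfl
  rw [h0]
  have h1 : paramD p y (chartField (K.liftField l) p y) = K.liftField l (param p y) := by
    rw [chartField_eq _ hy'.1]
    exact congrArg (fun f : Model (D + 1) →L[ℝ] Model (D + 1) ↦ f (K.liftField l (param p y)))
      (paramD_comp_chartD hy'.1)
  have h2 : lc y = chartD (K.proj p) (K.proj (param p y)) (l (K.proj (param p y))) :=
    chartField_extChartAt l hy'.2
  have h3 : chartForm K.A (K.proj p) (K.chartProj p y) (lc y) =
      K.A (K.proj (param p y)) (l (K.proj (param p y))) := by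
    rw [h2]
    exact chartForm_extChartAt K.A hy'.2 _
  refine Prod.ext ?_ ?_
  · simp only [w, S]
    rw [chartφ_chartProj hy'.2, h2]
    refine Eq.trans ?_ ((fderiv_chartProj hy' _).trans ((congrArg (fun v : Model (D + 1) ↦
      chartD (K.proj p) (K.proj (param p y)) (K.dproj (param p y) v)) h1).trans
      ((congrArg (chartD (K.proj p) (K.proj (param p y)))
      (K.dproj_lift (param p y) _)).trans (map_smul _ _ _)))).symm
    rfl
  · simp only [w, S]
    rw [chartφ_chartProj hy'.2, h3]
    have h4 := (mvfderiv_param K.smooth_z hy'.1 (chartField (K.liftField l) p y)).trans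
      ((congrArg (fun v : Model (D + 1) ↦ mvfderiv (𝓡 (D + 1)) K.z (param p y) v) h1).trans
        (K.dz_lift (param p y) _))
    refine Eq.trans ?_ h4.symm
    simp

end Reduction

end Reduction

/-! ### Homogeneity, the Leibniz rule and derivatives of exponentials -/

section Chart

variable {D : ℕ} {M : Type*} [TopologicalSpace M] [ChartedSpace (Model D) M]
  [IsManifold (𝓡 D) ∞ M] (g : LorentzianMetric D M)

omit [IsManifold (𝓡 D) ∞ M] in
lemma chartVec_smul (x : M) (a : ℝ) (v : TangentSpace (𝓡 D) x) :
    chartVec x (a • v) = a • chartVec x v :=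
  map_smul (mfderiv (𝓡 D) 𝓘(ℝ, Model D) (extChartAt (𝓡 D) x) x) a v

omit [IsManifold (𝓡 D) ∞ M] in
lemma chartVec_add (x : M) (u v : TangentSpace (𝓡 D) x) :
    chartVec x (u + v) = chartVec x u + chartVec x v :=
  map_add (mfderiv (𝓡 D) 𝓘(ℝ, Model D) (extChartAt (𝓡 D) x) x) u v

lemma chartVec_injective (x : M) :
    Function.Injective (chartVec x : TangentSpace (𝓡 D) x → Model D) := by
  intro u v h
  rwa [chartVec_eq, chartVec_eq] at h

set_option synthInstance.maxHeartbeats 200000 in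
lemma trilin_smul {E : Type*} [NormedAddCommGroup E] [NormedSpace ℝ E]
    (T : E →L[ℝ] E →L[ℝ] E →L[ℝ] ℝ) (a b c : ℝ) (u v w : E) :
    T (a • u) (b • v) (c • w) = a * b * c * T u v w := by
  rw [map_smul, map_smul, map_smul, smul_apply, smul_apply, smul_apply, smul_eq_mul, smul_eq_mul,
    smul_eq_mul]
  ring

lemma dMetric_smul (x : M) (a b c : ℝ) (u v w : Model D) :
    dMetric g x (a • u) (b • v) (c • w) = a * b * c * dMetric g x u v w :=
  trilin_smul _ a b c u v w

lemma ricciRot_smul (l : (x : M) → TangentSpace (𝓡 D) x) (x : M) (a b : ℝ)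
    (u v : TangentSpace (𝓡 D) x) :
    ricciRot g l x (a • u) (b • v) = a * b * ricciRot g l x u v := by
  rw [ricciRot_eq, ricciRot_eq]
  have h1 := dMetric_smul g x b a 1 (chartVec x v) (chartVec x u) (chartVec x (l x))
  have h2 := dMetric_smul g x a b 1 (chartVec x u) (chartVec x v) (chartVec x (l x))
  have h3 := dMetric_smul g x 1 b a (chartVec x (l x)) (chartVec x v) (chartVec x u)
  rw [one_smul] at h1 h2 h3
  rw [chartVec_smul, chartVec_smul, h1, h2, h3]
  simp only [map_smul, smul_apply, smul_eq_mul]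
  ring

lemma maxwell_smul (A : (x : M) → TangentSpace (𝓡 D) x →L[ℝ] ℝ) (x : M) (a : ℝ)
    (u v : TangentSpace (𝓡 D) x) : maxwell g A x u (a • v) = a * maxwell g A x u v := by
  rw [maxwell_eq, maxwell_eq]
  simp only [chartVec_smul, map_smul, smul_apply, smul_eq_mul]
  ring

lemma maxwell_self (A : (x : M) → TangentSpace (𝓡 D) x →L[ℝ] ℝ) (x : M)
    (u : TangentSpace (𝓡 D) x) : maxwell g A x u u = 0 :=
  sub_self _

lemma ricciRot_zero_left (l : (x : M) → TangentSpace (𝓡 D) x) (x : M)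
    (v : TangentSpace (𝓡 D) x) : ricciRot g l x 0 v = 0 := by
  simpa using ricciRot_smul g l x 0 1 0 v

lemma ricciRot_zero_right (l : (x : M) → TangentSpace (𝓡 D) x) (x : M)
    (u : TangentSpace (𝓡 D) x) : ricciRot g l x u 0 = 0 := by
  simpa using ricciRot_smul g l x 1 0 u 0

lemma maxwell_zero_right (A : (x : M) → TangentSpace (𝓡 D) x →L[ℝ] ℝ) (x : M)
    (u : TangentSpace (𝓡 D) x) : maxwell g A x u 0 = 0 := by
  simpa using maxwell_smul g A x 0 u 0

lemma christoffel_smul (x : M) (a b : ℝ) (v u : Model D) :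
    christoffel g x (a • v) (b • u) = (a * b) • christoffel g x v u := by
  obtain ⟨e, he⟩ := chartMetric_isInvertible g x
  have hinj : Function.Injective (chartMetric g x (extChartAt (𝓡 D) x x)) := by
    rw [← he]; exact e.injective
  apply hinj
  ext w
  rw [map_smul, smul_apply, christoffel_spec, christoffel_spec]
  have h1 := dMetric_smul g x a b 1 v u w
  have h2 := dMetric_smul g x b a 1 u v w
  have h3 := dMetric_smul g x 1 a b w v u
  rw [one_smul] at h1 h2 h3
  rw [h1, h2, h3, smul_eq_mul]
  ring

lemma covField_smul_right (X : (x : M) → TangentSpace (𝓡 D) x) (x : M) (a : ℝ)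
    (v : TangentSpace (𝓡 D) x) : covField g X x (a • v) = a • covField g X x v := by
  apply chartVec_injective x
  have h := christoffel_smul g x a 1 (chartVec x v) (chartVec x (X x))
  rw [one_smul, mul_one] at h
  rw [chartVec_smul, chartVec_covField, chartVec_covField, chartVec_smul, h, map_smul, smul_add]

/-- The Leibniz rule for the covariant derivative of a vector field. -/
lemma covField_smul {f : M → ℝ} (hf : ContMDiff (𝓡 D) 𝓘(ℝ, ℝ) ∞ f)
    {X : (x : M) → TangentSpace (𝓡 D) x} (hX : SmoothField X) (x : M)
    (v : TangentSpace (𝓡 D) x) :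
    covField g (fun x ↦ f x • X x) x v = f x • covField g X x v + diff f x v • X x := by
  apply chartVec_injective x
  have h := christoffel_smul g x 1 (f x) (chartVec x v) (chartVec x (X x))
  rw [one_smul, one_mul] at h
  rw [chartVec_add, chartVec_smul, chartVec_smul, chartVec_covField, chartVec_covField,
    chartVec_smul, h, diff_eq hf]
  have h1 : chartField (fun x ↦ f x • X x) x = fun y ↦ f (param x y) • chartField X x y := by
    funext y
    exact map_smul (paramDeriv x y).inverse (f (param x y)) (X (param x y))
  have h2 : DifferentiableAt ℝ (fun y ↦ f (param x y)) (extChartAt (𝓡 D) x x) :=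
    (contDiffAt_comp_param (hf x)).differentiableAt (by simp)
  rw [h1, fderiv_fun_smul h2 ((contDiffAt_chartField hX x).differentiableAt (by simp)),
    chartField_self, param_extChartAt_self]
  simp only [add_apply, smul_apply, ContinuousLinearMap.smulRight_apply, smul_add]
  abel

omit [IsManifold (𝓡 D) ∞ M] in
lemma contMDiff_exp {φ : M → ℝ} (hφ : ContMDiff (𝓡 D) 𝓘(ℝ, ℝ) ∞ φ) (k : ℝ) :
    ContMDiff (𝓡 D) 𝓘(ℝ, ℝ) ∞ (fun x ↦ Real.exp (k * φ x)) :=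
  (Real.contDiff_exp.comp (contDiff_const.mul contDiff_id)).contMDiff.comp
    (g := fun t : ℝ ↦ Real.exp (k * t)) hφ

lemma diff_exp {φ : M → ℝ} (hφ : ContMDiff (𝓡 D) 𝓘(ℝ, ℝ) ∞ φ) (k : ℝ) (x : M)
    (v : TangentSpace (𝓡 D) x) :
    diff (fun x ↦ Real.exp (k * φ x)) x v = k * Real.exp (k * φ x) * diff φ x v := by
  rw [diff_eq (contMDiff_exp hφ k), diff_eq hφ]
  have h := (((contDiffAt_comp_param (hφ x)).differentiableAt (by simp)).hasFDerivAt.const_mul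
    k).exp
  rw [h.fderiv, param_extChartAt_self]
  simp only [smul_apply, smul_eq_mul]
  ring

end Chart

/-! ### Ricci rotation coefficients and non-geodeticity of the lift -/

namespace Reduction

variable {D : ℕ} {M : Type*} [TopologicalSpace M] [ChartedSpace (Model D) M]
  [IsManifold (𝓡 D) ∞ M]
  {N : Type*} [TopologicalSpace N] [ChartedSpace (Model (D + 1)) N]
  [IsManifold (𝓡 (D + 1)) ∞ N]
  {α β : ℝ} {g : LorentzianMetric D M} {gh : LorentzianMetric (D + 1) N}
  (K : Reduction α β g gh)

/-- The Ricci rotation coefficients of a lifted null field, on arbitrary vectors. -/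
lemma ricciRot_liftField {l : (x : M) → TangentSpace (𝓡 D) x} (hl : SmoothField l) (p : N)
    (u v : TangentSpace (𝓡 (D + 1)) p) :
    ricciRot gh (K.liftField l) p u v = Real.exp (α * K.φ (K.proj p)) *
        (ricciRot g l (K.proj p) (K.dproj p u) (K.dproj p v) -
          α * diff K.φ (K.proj p) (K.dproj p u) *
            g.val (K.proj p) (l (K.proj p)) (K.dproj p v) +
          α * diff K.φ (K.proj p) (l (K.proj p)) *
            g.val (K.proj p) (K.dproj p u) (K.dproj p v)) +
      1 / 2 * (Real.exp (-α * K.φ (K.proj p)) * Real.exp (2 * β * K.φ (K.proj p))) *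
        (K.gauge p u * maxwell g K.A (K.proj p) (l (K.proj p)) (K.dproj p v) +
          K.gauge p v * maxwell g K.A (K.proj p) (l (K.proj p)) (K.dproj p u) +
          2 * β * diff K.φ (K.proj p) (l (K.proj p)) * (K.gauge p u * K.gauge p v)) := by
  have hform : fderiv ℝ (chartForm (fun q ↦ gh.val q (K.liftField l q)) p)
      (extChartAt (𝓡 (D + 1)) p p) (chartVec p v) (chartVec p u) =
      fderiv ℝ (kkForm (K.chartProj p) (chartForm (fun x ↦ g.val x (l x)) (K.proj p))
        (K.chartφ p) α (chartVec p u)) (extChartAt (𝓡 (D + 1)) p p) (chartVec p v) := by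
    -- The Koszul form differentiates an operator-valued map, the calculus lemma a scalar function.
    -- They agree because the lowered lift is differentiable, which rests on smoothness of the lift.
    have hd := differentiableAt_chartForm_lower gh (K.smoothField_liftField hl) p
    have h : (fun y ↦ chartForm (fun q ↦ gh.val q (K.liftField l q)) p y (chartVec p u))
        =ᶠ[nhds (extChartAt (𝓡 (D + 1)) p p)] kkForm (K.chartProj p)
          (chartForm (fun x ↦ g.val x (l x)) (K.proj p)) (K.chartφ p) α (chartVec p u) := by
      filter_upwards [K.eventually_mem_charts p] with y hy using chartForm_liftField l hy _
    rw [← h.fderiv_eq, fderiv_clm_apply hd (differentiableAt_const _)]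
    simp
  rw [ricciRot_eq, hform, dMetric_eq (K := K), dMetric_eq (K := K), dMetric_eq (K := K)]
  have hy := K.chartProj_self p
  have hφ : K.chartφ p (extChartAt (𝓡 D) (K.proj p) (K.proj p)) = K.φ (K.proj p) := by
    rw [chartφ, param_extChartAt_self]
  have h := kk_koszul (P := K.chartProj p) (ζ := K.chartZ p) (G := chartMetric g (K.proj p))
    (A := chartForm K.A (K.proj p)) (θ := chartForm (fun x ↦ g.val x (l x)) (K.proj p))
    (f := K.chartφ p) (α := α) (β := β) (y := extChartAt (𝓡 (D + 1)) p p)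
    (X := chartVec (K.proj p) (l (K.proj p))) (Xh := chartVec p (K.liftField l p))
    ((K.contDiffAt_chartProj p).of_le (WithTop.coe_le_coe.2 (le_top : (2 : ℕ∞) ≤ ⊤)))
    ((K.contDiffAt_chartZ p).of_le (WithTop.coe_le_coe.2 (le_top : (2 : ℕ∞) ≤ ⊤)))
    (by rw [hy]; exact differentiableAt_chartMetric g _)
    (by rw [hy]; exact (contDiffAt_chartForm K.smooth_A _).differentiableAt (by simp))
    (by rw [hy]; exact differentiableAt_chartForm_lower g hl _)
    (by rw [hy]; exact (K.contDiffAt_chartφ p).differentiableAt (by simp))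
    (fun a b ↦ chartMetric_symm g _ _ a b)
    (by
      intro a
      obtain ⟨a, rfl⟩ : ∃ b : TangentSpace (𝓡 D) (K.proj p), chartVec (K.proj p) b = a :=
        ⟨a, chartVec_eq _ a⟩
      rw [hy, chartForm_self, chartMetric_self])
    (by
      rw [hy, hφ, fderiv_chartProj_self, liftField, dproj_lift, chartVec_smul])
    (by rw [gaugeForm_chart_self]; exact K.gauge_lift p _)
    (chartVec p u) (chartVec p v)
  rw [h, hy, hφ, fderiv_chartProj_self, fderiv_chartProj_self, gaugeForm_chart_self,
    gaugeForm_chart_self, chartMetric_self, chartMetric_self, ricciRot_eq, maxwell_eq, maxwell_eq,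
    diff_eq K.smooth_φ, diff_eq K.smooth_φ]
  rfl

/-- The lift of vectors as a linear map. -/
def liftLinear (p : N) : TangentSpace (𝓡 D) (K.proj p) →ₗ[ℝ] TangentSpace (𝓡 (D + 1)) p :=
  Real.exp (-α * K.φ (K.proj p)) •
    ((K.split p).symm.toLinearMap ∘ₗ LinearMap.inl ℝ _ ℝ -
      (K.A (K.proj p)).toLinearMap.smulRight (K.delZ p))

lemma liftLinear_apply (p : N) (v : TangentSpace (𝓡 D) (K.proj p)) :
    K.liftLinear p v = K.lift p v := rfl

lemma lift_injective (p : N) : Function.Injective (K.lift p) := by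
  intro u v h
  have h1 := congrArg (K.dproj p) h
  rw [dproj_lift, dproj_lift] at h1
  exact smul_right_injective _ (Real.exp_ne_zero _) h1

lemma lift_eq_zero_iff (p : N) (v : TangentSpace (𝓡 D) (K.proj p)) : K.lift p v = 0 ↔ v = 0 := by
  rw [← liftLinear_apply]
  exact map_eq_zero_iff (K.liftLinear p) (K.lift_injective p)

lemma isNullField_liftField {l : (x : M) → TangentSpace (𝓡 D) x} (hl : IsNullField g l) :
    IsNullField gh (K.liftField l) where
  smooth := K.smoothField_liftField hl.smooth
  ne_zero p := fun h ↦ hl.ne_zero _ ((K.lift_eq_zero_iff p _).1 h)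
  null p := by
    rw [liftField, val_lift_left, dproj_lift, map_smul, hl.null, smul_zero, mul_zero]

/-- The non-geodeticity of a lifted null field is a lift. -/
lemma nonGeod_liftField {l : (x : M) → TangentSpace (𝓡 D) x} (hl : IsNullField g l) (p : N) :
    nonGeod gh (K.liftField l) p = K.lift p (Real.exp (-α * K.φ (K.proj p)) •
        nonGeod g l (K.proj p) -
      diff (fun x ↦ Real.exp (-α * K.φ x)) (K.proj p) (l (K.proj p)) • l (K.proj p)) := by
  rw [← sub_eq_zero]
  -- Both sides are tested against an arbitrary `u`. Here `g(ℓ,ℓ) = 0` removes the term with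
  -- `dφ(u)`, while `F(ℓ,ℓ) = 0` and the vanishing gauge form of the lift remove everything
  -- multiplied by `e^{2βφ}`.
  refine nondegenerate gh fun u ↦ ?_
  rw [map_sub, sub_apply, sub_eq_zero, nonGeod, val_covField gh (K.smoothField_liftField hl.smooth),
    K.ricciRot_liftField hl.smooth, liftField, gauge_lift, dproj_lift, val_lift_left,
    maxwell_smul, maxwell_self, diff_exp K.smooth_φ, map_sub, map_smul, map_smul, map_smul,
    map_smul, hl.null, sub_apply, smul_apply, smul_apply, nonGeod, val_covField g hl.smooth,
    g.symm _ (K.dproj p u)]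
  have h := ricciRot_smul g l (K.proj p) 1 (Real.exp (-α * K.φ (K.proj p))) (K.dproj p u)
    (l (K.proj p))
  rw [one_smul] at h
  rw [h]
  simp only [smul_eq_mul]
  ring

/-- The non-geodeticity of a lifted null field, in terms of the rescaled field. -/
lemma nonGeod_liftField' {l : (x : M) → TangentSpace (𝓡 D) x} (hl : IsNullField g l) (p : N) :
    nonGeod gh (K.liftField l) p = K.lift p (Real.exp (-2 * α * K.φ (K.proj p)) •
      covField g (fun x ↦ Real.exp (α * K.φ x) • l x) (K.proj p) (l (K.proj p))) := by
  rw [K.nonGeod_liftField hl, covField_smul g (contMDiff_exp K.smooth_φ α) hl.smooth,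
    diff_exp K.smooth_φ, diff_exp K.smooth_φ, smul_add, smul_smul, smul_smul, ← Real.exp_add,
    sub_eq_add_neg, ← neg_smul]
  have h1 : -2 * α * K.φ (K.proj p) + α * K.φ (K.proj p) = -α * K.φ (K.proj p) := by ring
  have h2 : Real.exp (-2 * α * K.φ (K.proj p)) * Real.exp (α * K.φ (K.proj p)) =
    Real.exp (-α * K.φ (K.proj p)) := by rw [← Real.exp_add, h1]
  rw [h1]
  congr 3
  linear_combination (-α * diff K.φ (K.proj p) (l (K.proj p))) * h2

/-- The lift is injective, and replacing the direction `ℓ` by `e^{αφ} ℓ` only multiplies the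
derivative by a nonzero factor. Surjectivity of the projection reaches every point of `M`. -/
lemma isGeodetic_liftField_iff {l : (x : M) → TangentSpace (𝓡 D) x} (hl : IsNullField g l) :
    IsGeodetic gh (K.liftField l) ↔ IsGeodetic g (fun x ↦ Real.exp (α * K.φ x) • l x) := by
  have h : ∀ p, nonGeod gh (K.liftField l) p = 0 ↔
      nonGeod g (fun x ↦ Real.exp (α * K.φ x) • l x) (K.proj p) = 0 := by
    intro p
    rw [K.nonGeod_liftField' hl, lift_eq_zero_iff, nonGeod, covField_smul_right,
      smul_eq_zero_iff_right (Real.exp_ne_zero _), smul_eq_zero_iff_right (Real.exp_ne_zero _)]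
  exact ⟨fun h1 x ↦ by obtain ⟨p, rfl⟩ := K.surjective x; exact (h p).1 (h1 p),
    fun h1 p ↦ (h p).2 (h1 _)⟩

end Reduction

/-! ### Boost order -/

section Boost

variable {D : ℕ} {M : Type*} [TopologicalSpace M] [ChartedSpace (Model D) M]
  [IsManifold (𝓡 D) ∞ M] {g : LorentzianMetric D M}

lemma BoostOrderLE.eq_zero {l : (x : M) → TangentSpace (𝓡 D) x} {k : ℕ}
    {T : (x : M) → (Fin k → TangentSpace (𝓡 D) x) → ℝ} {b : ℤ} (h : BoostOrderLE g l T b) {x : M}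
    {e : Module.Basis (Fin D) ℝ (TangentSpace (𝓡 D) x)} (he : IsNullFrame g l x e)
    (a : Fin k → Fin D) (ha : b < boostWeight a) : T x (fun i ↦ e (a i)) = 0 := by
  by_contra hne
  have h1 := (Finset.sup_le_iff.1 (h x e he)) a (by simpa using hne)
  exact absurd (WithBot.coe_le_coe.1 h1) (not_le.2 ha)

end Boost

/-! ### Lifted frames, their components, and Kundt spacetimes -/

namespace Reduction

variable {D : ℕ} {M : Type*} [TopologicalSpace M] [ChartedSpace (Model D) M]
  [IsManifold (𝓡 D) ∞ M]
  {N : Type*} [TopologicalSpace N] [ChartedSpace (Model (D + 1)) N]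
  [IsManifold (𝓡 (D + 1)) ∞ N]
  {α β : ℝ} {g : LorentzianMetric D M} {gh : LorentzianMetric (D + 1) N}
  (K : Reduction α β g gh)

lemma val_lift_lift (p : N) (u v : TangentSpace (𝓡 D) (K.proj p)) :
    gh.val p (K.lift p u) (K.lift p v) = g.val (K.proj p) u v := by
  rw [val_lift_left, dproj_lift, map_smul, smul_eq_mul, ← mul_assoc, ← Real.exp_add]
  simp

lemma val_lift_liftZ (p : N) (u : TangentSpace (𝓡 D) (K.proj p)) :
    gh.val p (K.lift p u) (K.liftZ p) = 0 := by
  rw [val_lift_left, dproj_liftZ, map_zero, mul_zero]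

lemma val_liftZ_liftZ (p : N) : gh.val p (K.liftZ p) (K.liftZ p) = 1 := by
  rw [K.val_eq, dproj_liftZ, map_zero, mul_zero, zero_add, gauge_liftZ, ← Real.exp_add,
    ← Real.exp_add]
  ring_nf
  exact Real.exp_zero

/-- The lift of a basis, completed by the unit vector along `∂_z`. -/
lemma exists_lift_basis (p : N) (e : Module.Basis (Fin D) ℝ (TangentSpace (𝓡 D) (K.proj p))) :
    ∃ eh : Module.Basis (Fin (D + 1)) ℝ (TangentSpace (𝓡 (D + 1)) p),
      (∀ a : Fin D, eh a.castSucc = K.lift p (e a)) ∧ eh (Fin.last D) = K.liftZ p := by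
  let f : Fin (D + 1) → TangentSpace (𝓡 (D + 1)) p :=
    Fin.snoc (α := fun _ ↦ TangentSpace (𝓡 (D + 1)) p) (fun a ↦ K.lift p (e a)) (K.liftZ p)
  have hf : LinearIndependent ℝ f := by
    rw [linearIndependent_finSnoc]
    constructor
    · exact e.linearIndependent.map' (K.liftLinear p) (LinearMap.ker_eq_bot.2 (K.lift_injective p))
    · intro h
      -- The gauge form vanishes on the span of the lifts but not on the vector along `∂_z`, which
      -- is therefore independent of them.
      have h1 : K.gauge p (K.liftZ p) = 0 := by
        let γ : TangentSpace (𝓡 (D + 1)) p →L[ℝ] ℝ :=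
          mvfderiv (𝓡 (D + 1)) K.z p + (K.A (K.proj p)).comp (K.dproj p)
        have h2 : Submodule.span ℝ (range fun a ↦ K.lift p (e a)) ≤ LinearMap.ker γ.toLinearMap := by
          rw [Submodule.span_le]
          rintro _ ⟨a, rfl⟩
          exact K.gauge_lift p (e a)
        exact h2 h
      rw [gauge_liftZ] at h1
      exact Real.exp_ne_zero _ h1
  have hd : Fintype.card (Fin (D + 1)) = Module.finrank ℝ (TangentSpace (𝓡 (D + 1)) p) := by
    change _ = Module.finrank ℝ (Model (D + 1))
    simp
  refine ⟨basisOfLinearIndependentOfCardEqFinrank hf hd, fun a ↦ ?_, ?_⟩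
  · rw [coe_basisOfLinearIndependentOfCardEqFinrank]
    simp [f]
  · rw [coe_basisOfLinearIndependentOfCardEqFinrank]
    simp [f]

variable {p : N} {e : Module.Basis (Fin D) ℝ (TangentSpace (𝓡 D) (K.proj p))}
  {eh : Module.Basis (Fin (D + 1)) ℝ (TangentSpace (𝓡 (D + 1)) p)}
  {l : (x : M) → TangentSpace (𝓡 D) x}

lemma isNullFrame_lift (hD : 2 ≤ D) (he : IsNullFrame g l (K.proj p) e)
    (h1 : ∀ a : Fin D, eh a.castSucc = K.lift p (e a)) (h2 : eh (Fin.last D) = K.liftZ p) :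
    IsNullFrame gh (K.liftField l) p eh where
  first a ha := by
    induction a using Fin.lastCases with
    | last => simp only [Fin.val_last] at ha; omega
    | cast a => rw [h1, he.first a (by simpa using ha)]; rfl
  gram a b := by
    induction a using Fin.lastCases with
    | last =>
      induction b using Fin.lastCases with
      | last =>
        -- The last index is `D ≥ 2`, hence transverse.
        rw [h2, val_liftZ_liftZ, if_pos]
        simp [hD]
      | cast b =>
        rw [h1, h2, gh.symm, val_lift_liftZ, if_neg]
        have := b.2
        simp only [Fin.ext_iff, Fin.val_last, Fin.val_castSucc]
        omega
    | cast a =>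
      induction b using Fin.lastCases with
      | last =>
        rw [h1, h2, val_lift_liftZ, if_neg]
        have := a.2
        simp only [Fin.ext_iff, Fin.val_last, Fin.val_castSucc]
        omega
      | cast b =>
        rw [h1, h1, val_lift_lift, he.gram]
        simp [Fin.ext_iff]

lemma repr_lift (h1 : ∀ a : Fin D, eh a.castSucc = K.lift p (e a))
    (w : TangentSpace (𝓡 D) (K.proj p)) :
    (∀ a : Fin D, eh.repr (K.lift p w) a.castSucc = e.repr w a) ∧
      eh.repr (K.lift p w) (Fin.last D) = 0 := by
  have hw : K.lift p w = ∑ a, e.repr w a • eh a.castSucc := by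
    conv_lhs => rw [← e.sum_repr w]
    rw [← liftLinear_apply, map_sum]
    exact Finset.sum_congr rfl fun a _ ↦ by rw [map_smul, h1, liftLinear_apply]
  rw [hw, map_sum]
  constructor
  · intro a
    simp [Finsupp.single_apply]
  · simp

lemma ricciRot_lift_lift (hl : SmoothField l) (p : N) (u v : TangentSpace (𝓡 D) (K.proj p)) :
    ricciRot gh (K.liftField l) p (K.lift p u) (K.lift p v) =
      Real.exp (-α * K.φ (K.proj p)) * ricciRot g l (K.proj p) u v -
      diff (fun x ↦ Real.exp (-α * K.φ x)) (K.proj p) (l (K.proj p)) * g.val (K.proj p) u v +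
      diff (fun x ↦ Real.exp (-α * K.φ x)) (K.proj p) u * g.val (K.proj p) (l (K.proj p)) v := by
  have h1 : Real.exp (α * K.φ (K.proj p)) * Real.exp (-α * K.φ (K.proj p)) = 1 := by
    rw [← Real.exp_add]; simp
  have h2 : diff K.φ (K.proj p) (Real.exp (-α * K.φ (K.proj p)) • u) =
    Real.exp (-α * K.φ (K.proj p)) * diff K.φ (K.proj p) u := map_smul (mvfderiv (𝓡 D) K.φ _) _ _
  rw [K.ricciRot_liftField hl, gauge_lift, gauge_lift, dproj_lift, dproj_lift, ricciRot_smul,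
    diff_exp K.smooth_φ, diff_exp K.smooth_φ, h2]
  simp only [map_smul, smul_apply, smul_eq_mul]
  linear_combination (Real.exp (-α * K.φ (K.proj p)) * (ricciRot g l (K.proj p) u v -
    α * diff K.φ (K.proj p) u * g.val (K.proj p) (l (K.proj p)) v +
    α * diff K.φ (K.proj p) (l (K.proj p)) * g.val (K.proj p) u v)) * h1

lemma ricciRot_lift_liftZ (hl : SmoothField l) (p : N) (u : TangentSpace (𝓡 D) (K.proj p)) :
    ricciRot gh (K.liftField l) p (K.lift p u) (K.liftZ p) =
      Real.exp ((-2 * α + β) * K.φ (K.proj p)) / 2 *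
        maxwell g K.A (K.proj p) (l (K.proj p)) u := by
  have h1 : Real.exp ((-2 * α + β) * K.φ (K.proj p)) = Real.exp (-α * K.φ (K.proj p)) ^ 2 *
      Real.exp (2 * β * K.φ (K.proj p)) * Real.exp (-β * K.φ (K.proj p)) := by
    rw [← Real.exp_nat_mul, ← Real.exp_add, ← Real.exp_add]
    congr 1
    push_cast
    ring
  rw [K.ricciRot_liftField hl, gauge_lift, gauge_liftZ, dproj_lift, dproj_liftZ,
    ricciRot_zero_right, maxwell_smul, map_zero, map_zero, h1]
  ring

/-- In the general formula the only surviving term is the one with `F`, which is symmetric in the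
two arguments. This is why the twist has no `z` components. -/
lemma ricciRot_liftZ_lift (hl : SmoothField l) (p : N) (u : TangentSpace (𝓡 D) (K.proj p)) :
    ricciRot gh (K.liftField l) p (K.liftZ p) (K.lift p u) =
      ricciRot gh (K.liftField l) p (K.lift p u) (K.liftZ p) := by
  have h : diff K.φ (K.proj p) 0 = 0 := map_zero (mvfderiv (𝓡 D) K.φ _)
  rw [K.ricciRot_liftField hl, K.ricciRot_liftField hl, gauge_lift, gauge_liftZ, dproj_lift,
    dproj_liftZ, ricciRot_zero_right, ricciRot_zero_left, map_zero, map_zero, map_zero, h]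
  simp

lemma ricciRot_liftZ_liftZ (hl : SmoothField l) (p : N) :
    ricciRot gh (K.liftField l) p (K.liftZ p) (K.liftZ p) =
      Real.exp ((-α - β) * K.φ (K.proj p)) *
        diff (fun x ↦ Real.exp (β * K.φ x)) (K.proj p) (l (K.proj p)) := by
  have h : diff K.φ (K.proj p) 0 = 0 := map_zero (mvfderiv (𝓡 D) K.φ _)
  have h1 : Real.exp (-α * K.φ (K.proj p)) * Real.exp (2 * β * K.φ (K.proj p)) *
      (Real.exp (-β * K.φ (K.proj p)) * Real.exp (-β * K.φ (K.proj p))) =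
      Real.exp ((-α - β) * K.φ (K.proj p)) * Real.exp (β * K.φ (K.proj p)) := by
    simp only [← Real.exp_add]
    congr 1
    ring
  rw [K.ricciRot_liftField hl, gauge_liftZ, dproj_liftZ, ricciRot_zero_right, maxwell_zero_right,
    map_zero, map_zero, h, diff_exp K.smooth_φ]
  linear_combination (β * diff K.φ (K.proj p) (l (K.proj p))) * h1

lemma transverse_cases {D : ℕ} (hD : 4 ≤ D) (i : Transverse (D + 1)) :
    (∃ j : Transverse D, i = j.up) ∨ i = Transverse.z hD := by
  obtain ⟨i, hi⟩ := i
  induction i using Fin.lastCases with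
  | last => exact Or.inr rfl
  | cast a => exact Or.inl ⟨⟨a, hi⟩, rfl⟩

/-- Each term of the lifted `κ` and optical matrix contains `κ`, the optical matrix downstairs,
`dφ(ℓ)`, `F(ℓ, e_(i))` or `g(ℓ, e_(j))`; all of these vanish. -/
lemma isKundt_liftField (hD : 4 ≤ D) (hK : IsKundt g l)
    (hF : BoostOrderLE g l (k := 2) (fun x v ↦ maxwell g K.A x (v 0) (v 1)) 0)
    (hφ : BoostOrderLE g l (k := 1) (fun x v ↦ diff K.φ x (v 0)) 0) :
    IsKundt gh (K.liftField l) := by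
  have hl := hK.nullField
  have hdφ : ∀ x, diff K.φ x (l x) = 0 := by
    intro x
    -- The Kundt condition supplies a null frame at `x`; in it `dφ(ℓ)` is the component of boost
    -- weight `1`.
    obtain ⟨e, he, -⟩ := hK.optical_eq_zero x
    have h := hφ.eq_zero he (fun _ ↦ ⟨0, by omega⟩) (by simp [boostWeight])
    rwa [he.first _ rfl] at h
  have hdexp : ∀ (k : ℝ) (x : M), diff (fun x ↦ Real.exp (k * K.φ x)) x (l x) = 0 := by
    intro k x
    rw [diff_exp K.smooth_φ, hdφ, mul_zero]
  refine ⟨K.isNullField_liftField hl, fun p ↦ ?_, fun p ↦ ?_⟩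
  · rw [K.nonGeod_liftField hl, hdexp, hK.geodetic, smul_zero, zero_smul, sub_zero,
      lift_eq_zero_iff]
  · obtain ⟨e, he, hρ⟩ := hK.optical_eq_zero (K.proj p)
    obtain ⟨eh, h1, h2⟩ := K.exists_lift_basis p e
    refine ⟨eh, K.isNullFrame_lift (by omega) he h1 h2, ?_⟩
    have hmax : ∀ i : Transverse D, maxwell g K.A (K.proj p) (l (K.proj p)) (e i.1) = 0 := by
      intro i
      have hi := i.2
      -- The component with indices `0` and `i` has boost weight `1`, as the transverse `i` is
      -- neither `0` nor `1`.
      have h := hF.eq_zero he ![⟨0, by omega⟩, i.1] (by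
        have h0 : (i.1 : ℕ) ≠ 0 := by omega
        have h1 : (i.1 : ℕ) ≠ 1 := by omega
        simp [boostWeight, Fin.univ_succ, Finset.filter_insert, Finset.filter_singleton, h0, h1])
      simp only [Matrix.cons_val_zero, Matrix.cons_val_one] at h
      rwa [he.first _ rfl] at h
    ext i j
    change ricciRot gh (K.liftField l) p (eh i.1) (eh j.1) = 0
    obtain ⟨i, rfl⟩ | rfl := transverse_cases hD i <;> obtain ⟨j, rfl⟩ | rfl := transverse_cases hD j
    · change ricciRot gh (K.liftField l) p (eh i.1.castSucc) (eh j.1.castSucc) = 0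
      have h3 : g.val (K.proj p) (l (K.proj p)) (e j.1) = 0 := by
        rw [← he.first ⟨0, by omega⟩ rfl, he.gram, if_neg]
        have := j.2
        simp only [Fin.ext_iff]
        omega
      have h4 : ricciRot g l (K.proj p) (e i.1) (e j.1) = 0 := congrFun (congrFun hρ i) j
      rw [h1, h1, K.ricciRot_lift_lift hl.smooth, hdexp, h3, h4]
      ring
    · change ricciRot gh (K.liftField l) p (eh i.1.castSucc) (eh (Fin.last D)) = 0
      rw [h1, h2, K.ricciRot_lift_liftZ hl.smooth, hmax, mul_zero]
    · change ricciRot gh (K.liftField l) p (eh (Fin.last D)) (eh j.1.castSucc) = 0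
      rw [h1, h2, K.ricciRot_liftZ_lift hl.smooth, K.ricciRot_lift_liftZ hl.smooth, hmax, mul_zero]
    · change ricciRot gh (K.liftField l) p (eh (Fin.last D)) (eh (Fin.last D)) = 0
      rw [h2, K.ricciRot_liftZ_liftZ hl.smooth, hdexp, mul_zero]

end Reduction

end KK

end

/-! ### Assembly of the frame components -/

theorem mainTheorem7 {D : ℕ} (hD : 4 ≤ D)
    {M : Type*} [TopologicalSpace M] [ChartedSpace (KK.Model D) M] [IsManifold (𝓡 D) ∞ M]
    {N : Type*} [TopologicalSpace N] [ChartedSpace (KK.Model (D + 1)) N]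
    [IsManifold (𝓡 (D + 1)) ∞ N]
    (g : KK.LorentzianMetric D M) (gh : KK.LorentzianMetric (D + 1) N)
    (α β : ℝ) (hα : α ≠ 0) (hβ : β ≠ 0) (K : KK.Reduction α β g gh)
    (l : (x : M) → TangentSpace (𝓡 D) x) (hl : KK.IsNullField g l) :
    (∀ (p : N) (e : Module.Basis (Fin D) ℝ (TangentSpace (𝓡 D) (K.proj p))),
      KK.IsNullFrame g l (K.proj p) e →
      ∃ eh : Module.Basis (Fin (D + 1)) ℝ (TangentSpace (𝓡 (D + 1)) p),
        (∀ a : Fin D, eh a.castSucc = K.lift p (e a)) ∧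
        eh (Fin.last D) = K.liftZ p ∧
        KK.IsNullFrame gh (K.liftField l) p eh ∧
        -- Ricci rotation coefficients
        (∀ a b : Fin D,
          KK.ricciRot gh (K.liftField l) p (eh a.castSucc) (eh b.castSucc) =
            Real.exp (-α * K.φ (K.proj p)) * KK.ricciRot g l (K.proj p) (e a) (e b) -
            KK.diff (fun x ↦ Real.exp (-α * K.φ x)) (K.proj p) (l (K.proj p)) *
              g.val (K.proj p) (e a) (e b) +
            KK.diff (fun x ↦ Real.exp (-α * K.φ x)) (K.proj p) (e a) *
              g.val (K.proj p) (l (K.proj p)) (e b)) ∧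
        (∀ a : Fin D,
          KK.ricciRot gh (K.liftField l) p (eh a.castSucc) (eh (Fin.last D)) =
            Real.exp ((-2 * α + β) * K.φ (K.proj p)) / 2 *
              KK.maxwell g K.A (K.proj p) (l (K.proj p)) (e a)) ∧
        (∀ a : Fin D,
          KK.ricciRot gh (K.liftField l) p (eh (Fin.last D)) (eh a.castSucc) =
            KK.ricciRot gh (K.liftField l) p (eh a.castSucc) (eh (Fin.last D))) ∧
        KK.ricciRot gh (K.liftField l) p (eh (Fin.last D)) (eh (Fin.last D)) =
          Real.exp ((-α - β) * K.φ (K.proj p)) *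
            KK.diff (fun x ↦ Real.exp (β * K.φ x)) (K.proj p) (l (K.proj p)) ∧
        -- optical matrix
        (∀ i j : KK.Transverse D,
          KK.optical gh (K.liftField l) p eh i.up j.up =
            Real.exp (-α * K.φ (K.proj p)) * KK.optical g l (K.proj p) e i j -
            KK.diff (fun x ↦ Real.exp (-α * K.φ x)) (K.proj p) (l (K.proj p)) *
              (if i = j then 1 else 0)) ∧
        (∀ i : KK.Transverse D,
          KK.optical gh (K.liftField l) p eh i.up (KK.Transverse.z hD) =
            KK.optical gh (K.liftField l) p eh (KK.Transverse.z hD) i.up ∧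
          KK.optical gh (K.liftField l) p eh (KK.Transverse.z hD) i.up =
            Real.exp ((-2 * α + β) * K.φ (K.proj p)) / 2 *
              KK.maxwell g K.A (K.proj p) (l (K.proj p)) (e i.1)) ∧
        KK.optical gh (K.liftField l) p eh (KK.Transverse.z hD) (KK.Transverse.z hD) =
          Real.exp ((-α - β) * K.φ (K.proj p)) *
            KK.diff (fun x ↦ Real.exp (β * K.φ x)) (K.proj p) (l (K.proj p)) ∧
        -- twist
        (∀ i j : KK.Transverse D,
          KK.twist gh (K.liftField l) p eh i.up j.up =
            Real.exp (-α * K.φ (K.proj p)) * KK.twist g l (K.proj p) e i j) ∧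
        (∀ i : KK.Transverse D,
          KK.twist gh (K.liftField l) p eh i.up (KK.Transverse.z hD) = 0) ∧
        -- non-geodeticity
        (∀ a : Fin D,
          eh.repr (KK.nonGeod gh (K.liftField l) p) a.castSucc =
            Real.exp (-α * K.φ (K.proj p)) * e.repr (KK.nonGeod g l (K.proj p)) a -
            KK.diff (fun x ↦ Real.exp (-α * K.φ x)) (K.proj p) (l (K.proj p)) *
              e.repr (l (K.proj p)) a) ∧
        (∀ a : Fin D,
          eh.repr (KK.nonGeod gh (K.liftField l) p) a.castSucc =
            Real.exp (-2 * α * K.φ (K.proj p)) *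
              e.repr (KK.covField g (fun x ↦ Real.exp (α * K.φ x) • l x) (K.proj p)
                (l (K.proj p))) a) ∧
        eh.repr (KK.nonGeod gh (K.liftField l) p) (Fin.last D) = 0) ∧
    -- geodetic fields
    (KK.IsGeodetic gh (K.liftField l) ↔
      KK.IsGeodetic g (fun x ↦ Real.exp (α * K.φ x) • l x)) ∧
    -- Kundt spacetimes
    (KK.IsKundt g l →
      KK.BoostOrderLE g l (k := 2) (fun x v ↦ KK.maxwell g K.A x (v 0) (v 1)) 0 →
      KK.BoostOrderLE g l (k := 1) (fun x v ↦ KK.diff K.φ x (v 0)) 0 →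
      KK.IsKundt gh (K.liftField l)) := by
  have hs := hl.smooth
  refine ⟨fun p e he ↦ ?_, K.isGeodetic_liftField_iff hl,
    fun hK hF hφ ↦ K.isKundt_liftField hD hK hF hφ⟩
  obtain ⟨eh, h1, h2⟩ := K.exists_lift_basis p e
  have hup : ∀ i : KK.Transverse D, eh i.up.1 = K.lift p (e i.1) := fun i ↦ h1 i.1
  have hz : eh (KK.Transverse.z hD).1 = K.liftZ p := h2
  have hopt : ∀ i j : KK.Transverse D, KK.optical gh (K.liftField l) p eh i.up j.up =
      Real.exp (-α * K.φ (K.proj p)) * KK.optical g l (K.proj p) e i j -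
      KK.diff (fun x ↦ Real.exp (-α * K.φ x)) (K.proj p) (l (K.proj p)) *
        (if i = j then 1 else 0) := by
    intro i j
    have hi := i.2
    have hj := j.2
    -- As `ℓ` is the first frame vector, it is orthogonal to the transverse ones; this removes the
    -- last term of the formula for the lifted coefficients.
    have h3 : g.val (K.proj p) (l (K.proj p)) (e j.1) = 0 := by
      rw [← he.first ⟨0, by omega⟩ rfl, he.gram, if_neg]
      simp only [Fin.ext_iff]
      omega
    have h4 : g.val (K.proj p) (e i.1) (e j.1) = if i = j then 1 else 0 := by
      rw [he.gram]
      refine if_congr ?_ rfl rfl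
      rw [Subtype.ext_iff]
      omega
    simp only [KK.optical, Matrix.of_apply]
    rw [hup, hup, K.ricciRot_lift_lift hs, h3, h4, mul_zero, add_zero]
  have hoptz : ∀ i : KK.Transverse D,
      KK.optical gh (K.liftField l) p eh i.up (KK.Transverse.z hD) =
        KK.optical gh (K.liftField l) p eh (KK.Transverse.z hD) i.up := by
    intro i
    simp only [KK.optical, Matrix.of_apply]
    rw [hup, hz, K.ricciRot_liftZ_lift hs]
  refine ⟨eh, h1, h2, K.isNullFrame_lift (by omega) he h1 h2, fun a b ↦ ?_, fun a ↦ ?_,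
    fun a ↦ ?_, ?_, hopt, fun i ↦ ⟨hoptz i, ?_⟩, ?_, fun i j ↦ ?_, fun i ↦ ?_, fun a ↦ ?_,
    fun a ↦ ?_, ?_⟩
  · rw [h1, h1, K.ricciRot_lift_lift hs]
  · rw [h1, h2, K.ricciRot_lift_liftZ hs]
  · rw [h1, h2, K.ricciRot_liftZ_lift hs]
  · rw [h2, K.ricciRot_liftZ_liftZ hs]
  · simp only [KK.optical, Matrix.of_apply]
    rw [hup, hz, K.ricciRot_liftZ_lift hs, K.ricciRot_lift_liftZ hs]
  · simp only [KK.optical, Matrix.of_apply]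
    rw [hz, K.ricciRot_liftZ_liftZ hs]
  · simp only [KK.twist, Matrix.smul_apply, Matrix.sub_apply, Matrix.transpose_apply, smul_eq_mul]
    rw [hopt, hopt]
    -- The Kronecker delta is symmetric, so it drops out of the twist.
    simp only [eq_comm (a := j)]
    ring
  · simp only [KK.twist, Matrix.smul_apply, Matrix.sub_apply, Matrix.transpose_apply, smul_eq_mul]
    rw [hoptz, sub_self, mul_zero]
  · rw [K.nonGeod_liftField hl, (K.repr_lift h1 _).1]
    simp
  · rw [K.nonGeod_liftField' hl, (K.repr_lift h1 _).1]
    simp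
  · rw [K.nonGeod_liftField hl, (K.repr_lift h1 _).2]
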